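/- Let $\Bbbk$ be a field, $n\ge 0$ and $\sigma\in S_n$ a permutation of $\{1,\dots,n\}$. Choose any decomposition $$\sigma=(x_{11}\ x_{12}\cdots x_{1,t(1)})\cdots(x_{m1}\ x_{m2}\cdots x_{m,t(m)})$$ into disjoint cycles, in any order and including the cycles of length $1$, so that every element of $\{1,\dots,n\}$ is exactly one $x_{ij}$; read the index $j$ of $x_{ij}$ modulo $t(i)$. Let $Q$ be the quiver with vertex set $\{1,\dots,n\}$ and the following arrows, for $1\le i\le m-1$, $1\le j\le t(i)$, $1\le l\le t(i+1)$: one arrow $\alpha_{ijl}\colon x_{ij}\to x_{i+1,l}$ if $i$ is odd, and one arrow $\beta_{ijl}\colon x_{i+1,l}\to x_{ij}$ if $i$ is even. Then $\sigma$ extends uniquely to an automorphism of $Q$, and hence to an automorphism $\sigma$ of the path algebra $\Bbbk Q$, regarded as a $\Bbbk$-linear category $C$ with object set $\{1,\dots,n\}$. Let $D=\operatorname{Hom}_\Bbbk(-,\Bbbk)$ and let $\hat C$ be the repetition of $C$: its objects are $x^{[i]}$ ($x\in C$, $i\in\mathbb Z$), its morphism spaces are $\hat C(x^{[i]},y^{[i]})=C(x,y)$,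 $\hat C(x^{[i]},y^{[i+1]})=D\,C(y,x)$, and $\hat C(x^{[i]},y^{[j]})=0$ otherwise, and the composition is given by that of $C$, the bimodule structure of $DC$, and zero on pairs of morphisms in $DC$. Let $\hat\sigma$ be the automorphism of $\hat C$ induced by $\sigma$ (with $\hat\sigma(x^{[i]})=(\sigma x)^{[i]}$), and let $\nu$ be the Nakayama automorphism of $\hat C$, $\nu(x^{[i]})=x^{[i+1]}$. For an automorphism $F=\nu^{\pm1}\hat\sigma$ let $\hat C/\langle F\rangle$ denote the algebra of the orbit category, that is, the algebra of all row and column finite matrices $(f_{q,p}\in\hat C(p,q))_{p,q\in\hat C}$ with $f_{Fq,Fp}=F(f_{q,p})$ for all $p,q$, and let $e_x$ be its idempotent given by the identities of the objects in the orbit of $x^{[0]}$. **Theorem.** Let $A=T^1_\sigma(\Bbbk Q)=\hat C/\langle\nu\hat\sigma\rangle$ be the twisted $1$-fold extension of $\Bbbk Q$ by $\sigma$. Then $A$ is a (finite-dimensional) self-injective algebra with $(\operatorname{rad}A)^3=0$; the elements $e_1,\dots,e_n$ form a complete system of orthogonal primitive idempotents of $A$ with pairwise nonisomorphic projective modules;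 and $\sigma$ is the Nakayama permutation of $A$: $$\operatorname{soc}(e_xA)\cong\operatorname{top}(e_{\sigma(x)}A)\quad\text{as right $A$-modules, for all }x\in\{1,\dots,n\}.$$ The same holds with left modules in place of right modules, if $\nu$ is replaced by the Nakayama automorphism for left modules, which is $\nu^{-1}$: for $A'=\hat C/\langle\nu^{-1}\hat\sigma\rangle$, the algebra $A'$ is finite-dimensional and self-injective, $(\operatorname{rad}A')^3=0$, the elements $e_1,\dots,e_n$ of $A'$ form a complete system of orthogonal primitive idempotents with pairwise nonisomorphic projective modules, and $\operatorname{soc}(A'e_x)\cong\operatorname{top}(A'e_{\sigma(x)})$ as left $A'$-modules, for all $x$. -/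

import Mathlib

open CategoryTheory

universe u v w

namespace TwistedExt

/-! ### Automorphisms of linear categories -/

section LinearAut

variable (k : Type u) [Field k] (C : Type w) [Category.{v} C] [Preadditive C] [Linear k C]

/-- An automorphism of a `k`-linear category (not an auto-equivalence up to isomorphism):
a `k`-linear functor that is bijective on objects and on every space of morphisms. -/
structure LinearAut where
  functor : C ⥤ C
  map_add : ∀ {X Y : C} (f g : X ⟶ Y), functor.map (f + g) = functor.map f + functor.map g
  map_smul : ∀ {X Y : C} (c : k) (f : X ⟶ Y), functor.map (c • f) = c • functor.map f
  obj_bijective : Function.Bijective functor.obj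
  map_bijective : ∀ X Y : C, Function.Bijective (functor.map : (X ⟶ Y) → _)

variable {k C}

/-- The composite automorphism: first `F`, then `G`. -/
def LinearAut.comp (F G : LinearAut k C) : LinearAut k C where
  functor := F.functor ⋙ G.functor
  map_add f g := by simp [F.map_add, G.map_add]
  map_smul c f := by simp [F.map_smul, G.map_smul]
  obj_bijective := G.obj_bijective.comp F.obj_bijective
  map_bijective X Y := (G.map_bijective _ _).comp (F.map_bijective X Y)

/-- The action of an automorphism on morphisms, as a linear isomorphism. -/
noncomputable def LinearAut.homEquiv (F : LinearAut k C) (X Y : C) :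
    (X ⟶ Y) ≃ₗ[k] (F.functor.obj X ⟶ F.functor.obj Y) :=
  LinearEquiv.ofBijective
    { toFun := F.functor.map, map_add' := F.map_add, map_smul' := F.map_smul }
    (F.map_bijective X Y)

theorem LinearAut.homEquiv_apply (F : LinearAut k C) {X Y : C} (f : X ⟶ Y) :
    F.homEquiv X Y f = F.functor.map f := rfl

theorem LinearAut.map_zero (F : LinearAut k C) (X Y : C) :
    F.functor.map (0 : X ⟶ Y) = 0 := (F.homEquiv X Y).map_zero

end LinearAut

/-! ### The orbit algebra of a linear category by a cyclic group of automorphisms -/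

section Orbit

variable {k : Type u} [Field k] {C : Type w} [Category.{v} C] [Preadditive C] [Linear k C]

/-- The matrices `f = (f p q : p ⟶ q)`, indexed by pairs of objects of `C`, which are row finite
and column finite and invariant under the group generated by the automorphism `F`
(equivalently: under `F`). -/
def orbitSubmodule (F : LinearAut k C) : Submodule k (∀ p q : C, (p ⟶ q)) where
  carrier := {f | (∀ p, {q | f p q ≠ 0}.Finite) ∧ (∀ q, {p | f p q ≠ 0}.Finite) ∧
    ∀ p q, f (F.functor.obj p) (F.functor.obj q) = F.functor.map (f p q)}
  add_mem' := by
    rintro f g ⟨hf1, hf2, hf3⟩ ⟨hg1, hg2, hg3⟩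
    refine ⟨fun p => ((hf1 p).union (hg1 p)).subset fun q hq => ?_,
      fun q => ((hf2 q).union (hg2 q)).subset fun p hp => ?_, fun p q => ?_⟩
    · by_contra hc
      simp only [Set.mem_union, Set.mem_ofPred_eq, not_or, not_not] at hc
      exact hq (by simp [hc.1, hc.2])
    · by_contra hc
      simp only [Set.mem_union, Set.mem_ofPred_eq, not_or, not_not] at hc
      exact hp (by simp [hc.1, hc.2])
    · simp [hf3, hg3, F.map_add]
  zero_mem' := by
    refine ⟨fun p => by simp, fun p => by simp, fun p q => ?_⟩
    simp [F.map_zero]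
  smul_mem' := by
    rintro c f ⟨hf1, hf2, hf3⟩
    refine ⟨fun p => (hf1 p).subset fun q hq => ?_,
      fun q => (hf2 q).subset fun p hp => ?_, fun p q => ?_⟩
    · intro h0
      exact hq (by simp [h0])
    · intro h0
      exact hp (by simp [h0])
    · simp [hf3, F.map_smul]

/-- The algebra of the orbit category `C / ⟨F⟩` whose objects are the `⟨F⟩`-orbits of objects of
`C` (for a free action with finitely many orbits): the morphisms from an orbit `a` to an orbit `b`
are the `⟨F⟩`-invariant families `(f p q)` with `p ∈ a`, `q ∈ b`, and the algebra is the direct sum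
of all these spaces of morphisms, with matrix multiplication. -/
def OrbitAlgebra (F : LinearAut k C) : Type (max w v) := orbitSubmodule F

namespace OrbitAlgebra

variable {F : LinearAut k C}

instance : AddCommGroup (OrbitAlgebra F) := inferInstanceAs (AddCommGroup (orbitSubmodule F))
instance : Module k (OrbitAlgebra F) := inferInstanceAs (Module k (orbitSubmodule F))

/-- The entry of a matrix at the pair `(p, q)`, a morphism from `p` to `q`. -/
def entry (f : OrbitAlgebra F) (p q : C) : p ⟶ q := f.1 p q

theorem finite_left (f : OrbitAlgebra F) (p : C) : {q | f.entry p q ≠ 0}.Finite := f.2.1 p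
theorem finite_right (f : OrbitAlgebra F) (q : C) : {p | f.entry p q ≠ 0}.Finite := f.2.2.1 q
theorem entry_map (f : OrbitAlgebra F) (p q : C) :
    f.entry (F.functor.obj p) (F.functor.obj q) = F.functor.map (f.entry p q) := f.2.2.2 p q

@[ext] theorem ext {f g : OrbitAlgebra F} (h : ∀ p q, f.entry p q = g.entry p q) : f = g :=
  Subtype.ext (funext fun p => funext fun q => h p q)

@[simp] theorem entry_add (f g : OrbitAlgebra F) (p q : C) :
    (f + g).entry p q = f.entry p q + g.entry p q := rfl
@[simp] theorem entry_zero (p q : C) : (0 : OrbitAlgebra F).entry p q = 0 := rfl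
@[simp] theorem entry_smul (c : k) (f : OrbitAlgebra F) (p q : C) :
    (c • f).entry p q = c • f.entry p q := rfl

open Classical in
/-- The family of identity morphisms on the objects in an `F`-stable set `S`. -/
noncomputable def idOn (F : LinearAut k C) (S : Set C) (hS : ∀ p, F.functor.obj p ∈ S ↔ p ∈ S) :
    OrbitAlgebra F :=
  ⟨fun p q => if h : p = q then (if p ∈ S then eqToHom h else 0) else 0, by
    refine ⟨fun p => (Set.finite_singleton p).subset fun q hq => ?_,
      fun q => (Set.finite_singleton q).subset fun p hp => ?_, fun p q => ?_⟩
    · by_contra hc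
      exact hq (dif_neg fun h => hc h.symm)
    · by_contra hc
      exact hp (dif_neg fun h => hc h)
    · by_cases h : p = q
      · subst h
        by_cases hp : p ∈ S
        · simp [hp, (hS p).2 hp]
        · have hp' : F.functor.obj p ∉ S := fun h => hp ((hS p).1 h)
          simp [hp, hp', F.map_zero]
      · have h' : F.functor.obj p ≠ F.functor.obj q := fun e => h (F.obj_bijective.1 e)
        simp [h, h', F.map_zero]⟩

/-- The `⟨F⟩`-orbit of an object. -/
def orbit (F : LinearAut k C) (p : C) : Set C :=
  {q | Relation.EqvGen (fun a b => F.functor.obj a = b) p q}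

/-- The identity of the orbit of `p`, as an element of the orbit algebra. -/
noncomputable def idempotent (F : LinearAut k C) (p : C) : OrbitAlgebra F :=
  idOn F (orbit F p) fun q =>
    ⟨fun h => h.trans _ _ _ (.symm _ _ (.rel q _ rfl)), fun h => h.trans _ _ _ (.rel q _ rfl)⟩

noncomputable instance : One (OrbitAlgebra F) := ⟨idOn F Set.univ fun _ => by simp⟩

open Classical in
theorem entry_one_self (p : C) : (1 : OrbitAlgebra F).entry p p = 𝟙 p := by
  change dite (p = p) _ _ = _
  rw [dif_pos rfl, if_pos (Set.mem_univ p), eqToHom_refl]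

theorem entry_one_ne {p q : C} (h : p ≠ q) : (1 : OrbitAlgebra F).entry p q = 0 :=
  dif_neg h

theorem support_comp_left (g f : OrbitAlgebra F) (p r : C) :
    (Function.support fun q => f.entry p q ≫ g.entry q r) ⊆ {q | f.entry p q ≠ 0} := by
  intro q hq h0
  exact hq (by simp [h0])

/-- Matrix multiplication; as for composition, the right factor is applied first. -/
noncomputable instance : Mul (OrbitAlgebra F) :=
  ⟨fun g f => ⟨fun p r => ∑ᶠ q, f.entry p q ≫ g.entry q r, by
    have key : ∀ p r, (∑ᶠ q, f.entry p q ≫ g.entry q r) ≠ 0 →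
        ∃ q, f.entry p q ≠ 0 ∧ g.entry q r ≠ 0 := by
      intro p r h
      by_contra hc
      push Not at hc
      refine h (finsum_eq_zero_of_forall_eq_zero fun q => ?_)
      by_cases hq : f.entry p q = 0
      · simp [hq]
      · simp [hc q hq]
    refine ⟨fun p => ((f.finite_left p).biUnion fun q _ => g.finite_left q).subset ?_,
      fun r => ((g.finite_right r).biUnion fun q _ => f.finite_right q).subset ?_,
      fun p r => ?_⟩
    · intro r hr
      obtain ⟨q, h1, h2⟩ := key p r hr
      exact Set.mem_biUnion h1 h2
    · intro p hp
      obtain ⟨q, h1, h2⟩ := key p r hp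
      exact Set.mem_biUnion h2 h1
    · have hfin := (f.finite_left p).subset (support_comp_left g f p r)
      have := map_finsum (F.homEquiv p r) hfin
      rw [F.homEquiv_apply] at this
      change (∑ᶠ q, f.entry (F.functor.obj p) q ≫ g.entry q (F.functor.obj r)) = _
      rw [this, ← finsum_comp_equiv (Equiv.ofBijective _ F.obj_bijective)]
      refine finsum_congr fun q => ?_
      rw [F.homEquiv_apply, Functor.map_comp, ← entry_map, ← entry_map]
      rfl⟩⟩

theorem entry_mul (g f : OrbitAlgebra F) (p r : C) :
    (g * f).entry p r = ∑ᶠ q, f.entry p q ≫ g.entry q r := rfl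

theorem entry_mul_eq_sum (g f : OrbitAlgebra F) (p r : C) (s : Finset C)
    (hs : ∀ q, f.entry p q ≠ 0 → q ∈ s) :
    (g * f).entry p r = ∑ q ∈ s, f.entry p q ≫ g.entry q r :=
  finsum_eq_sum_of_support_subset _ fun q hq => hs q (support_comp_left g f p r hq)

noncomputable instance : Ring (OrbitAlgebra F) where
  __ := (inferInstance : AddCommGroup (OrbitAlgebra F))
  mul := (· * ·)
  one := 1
  left_distrib a b c := by
    classical
    ext p r
    rw [entry_add, entry_mul_eq_sum _ _ _ _ ((b.finite_left p).toFinset ∪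
        (c.finite_left p).toFinset), entry_mul_eq_sum a b p r ((b.finite_left p).toFinset ∪
        (c.finite_left p).toFinset), entry_mul_eq_sum a c p r ((b.finite_left p).toFinset ∪
        (c.finite_left p).toFinset), ← Finset.sum_add_distrib]
    · simp [Preadditive.add_comp]
    · intro q h; simp [h]
    · intro q h; simp [h]
    · intro q h
      by_contra hc
      simp only [Finset.mem_union, Set.Finite.mem_toFinset, Set.mem_ofPred_eq, not_or,
        not_not] at hc
      exact h (by simp [hc.1, hc.2])
  right_distrib a b c := by
    ext p r
    have hc : ∀ q, c.entry p q ≠ 0 → q ∈ (c.finite_left p).toFinset := by simp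
    rw [entry_add, entry_mul_eq_sum _ _ _ _ _ hc, entry_mul_eq_sum _ _ _ _ _ hc,
      entry_mul_eq_sum _ _ _ _ _ hc, ← Finset.sum_add_distrib]
    simp [Preadditive.comp_add]
  zero_mul a := by
    ext p r
    rw [entry_mul]
    simp
  mul_zero a := by
    ext p r
    rw [entry_mul]
    simp
  mul_assoc a b c := by
    classical
    ext p r
    let s := (c.finite_left p).toFinset
    let t := s.biUnion fun q => (b.finite_left q).toFinset
    have hs : ∀ q, c.entry p q ≠ 0 → q ∈ s := by simp [s]
    have ht : ∀ q ∈ s, ∀ x, b.entry q x ≠ 0 → x ∈ t := fun q hq x hx =>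
      Finset.mem_biUnion.2 ⟨q, hq, by simpa using hx⟩
    have ht' : ∀ x, (b * c).entry p x ≠ 0 → x ∈ t := by
      intro x hx
      rw [entry_mul_eq_sum _ _ _ _ s hs] at hx
      obtain ⟨q, hq, hne⟩ := Finset.exists_ne_zero_of_sum_ne_zero hx
      exact ht q hq x fun h0 => hne (by simp [h0])
    rw [entry_mul_eq_sum _ _ _ _ s hs, entry_mul_eq_sum _ _ _ _ t ht']
    have h1 : ∀ q ∈ s, c.entry p q ≫ (a * b).entry q r =
        ∑ x ∈ t, c.entry p q ≫ b.entry q x ≫ a.entry x r := fun q hq => by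
      rw [entry_mul_eq_sum _ _ _ _ t (ht q hq), Preadditive.comp_sum]
    have h2 : ∀ x ∈ t, (b * c).entry p x ≫ a.entry x r =
        ∑ q ∈ s, c.entry p q ≫ b.entry q x ≫ a.entry x r := fun x _ => by
      rw [entry_mul_eq_sum _ _ _ _ s hs, Preadditive.sum_comp]
      simp
    rw [Finset.sum_congr rfl h1, Finset.sum_congr rfl h2, Finset.sum_comm]
  one_mul a := by
    ext p r
    rw [entry_mul, finsum_eq_single _ r fun q hq => by rw [entry_one_ne hq]; simp,
      entry_one_self, Category.comp_id]
  mul_one a := by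
    ext p r
    rw [entry_mul, finsum_eq_single _ p fun q hq => by rw [entry_one_ne hq.symm]; simp,
      entry_one_self, Category.id_comp]

noncomputable instance : Algebra k (OrbitAlgebra F) :=
  Algebra.ofModule
    (fun c a b => by
      ext p r
      have hb : ∀ q, b.entry p q ≠ 0 → q ∈ (b.finite_left p).toFinset := by simp
      rw [entry_smul, entry_mul_eq_sum _ _ _ _ _ hb, entry_mul_eq_sum _ _ _ _ _ hb,
        Finset.smul_sum]
      simp)
    (fun c a b => by
      ext p r
      have hb : ∀ q, b.entry p q ≠ 0 → q ∈ (b.finite_left p).toFinset := by simp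
      rw [entry_smul, entry_mul_eq_sum _ _ _ _ _ hb, entry_mul_eq_sum _ _ _ _
        (b.finite_left p).toFinset (fun q h => hb q fun h0 => h (by simp [h0])), Finset.smul_sum]
      simp)

end OrbitAlgebra

end Orbit

/-! ### The repetition of a linear category -/

section Repetition

/-- The objects `x^[i]`, `i ∈ ℤ`, of the repetition of `C`. -/
@[ext] structure Repetition (k : Type u) (C : Type w) where
  base : C
  level : ℤ

variable {k : Type u} [Field k] {C : Type w} [Category.{v} C] [Preadditive C] [Linear k C]

namespace Repetition

/-- The morphisms `x^[i] ⟶ y^[j]`: this is `C(x, y)` if `j = i`, the dual space `D C(y, x)` if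
`j = i + 1`, and zero otherwise; it is written as the space of all pairs in
`C(x, y) × D C(y, x)` whose first (second) entry is zero unless `j = i` (`j = i + 1`). -/
def homSubmodule (X Y : Repetition k C) :
    Submodule k ((X.base ⟶ Y.base) × Module.Dual k (Y.base ⟶ X.base)) where
  carrier := {f | (Y.level ≠ X.level → f.1 = 0) ∧ (Y.level ≠ X.level + 1 → f.2 = 0)}
  add_mem' := by
    rintro f g ⟨hf1, hf2⟩ ⟨hg1, hg2⟩
    exact ⟨fun h => by simp [hf1 h, hg1 h], fun h => by simp [hf2 h, hg2 h]⟩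
  zero_mem' := by simp
  smul_mem' := by
    rintro c f ⟨hf1, hf2⟩
    exact ⟨fun h => by simp [hf1 h], fun h => by simp [hf2 h]⟩

/-- The bimodule structure of the dual: `(φ ≫ g)(h) = φ (g ≫ h)` for `φ ∈ D C(y, x)`,
`g : y ⟶ z`. -/
def dualComp {x y z : C} (φ : Module.Dual k (y ⟶ x)) (g : y ⟶ z) : Module.Dual k (z ⟶ x) :=
  φ ∘ₗ Linear.leftComp k x g

/-- The bimodule structure of the dual: `(f ≫ ψ)(h) = ψ (h ≫ f)` for `f : x ⟶ y`,
`ψ ∈ D C(z, y)`. -/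
def compDual {x y z : C} (f : x ⟶ y) (ψ : Module.Dual k (z ⟶ y)) : Module.Dual k (z ⟶ x) :=
  ψ ∘ₗ Linear.rightComp k z f

@[simp] theorem dualComp_apply {x y z : C} (φ : Module.Dual k (y ⟶ x)) (g : y ⟶ z) (h : z ⟶ x) :
    dualComp φ g h = φ (g ≫ h) := rfl
@[simp] theorem compDual_apply {x y z : C} (f : x ⟶ y) (ψ : Module.Dual k (z ⟶ y)) (h : z ⟶ x) :
    compDual f ψ h = ψ (h ≫ f) := rfl

/-- Composition in the repetition is given by composition in `C` and the bimodule structure of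
`D C`; two morphisms in `D C` compose to zero. -/
instance : Category (Repetition k C) where
  Hom X Y := homSubmodule X Y
  id X := ⟨(𝟙 X.base, 0), by simp [homSubmodule]⟩
  comp {X Y Z} f g := ⟨(f.1.1 ≫ g.1.1, dualComp f.1.2 g.1.1 + compDual f.1.1 g.1.2), by
    obtain ⟨⟨f, φ⟩, hf, hφ⟩ := f
    obtain ⟨⟨g, ψ⟩, hg, hψ⟩ := g
    dsimp only at hf hφ hg hψ ⊢
    constructor
    · intro h
      by_cases h1 : Y.level = X.level
      · rw [hg (by omega)]; simp
      · rw [hf h1]; simp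
    · intro h
      have e1 : dualComp φ g = 0 := by
        by_cases h1 : Y.level = X.level + 1
        · rw [hg (by omega)]; ext; simp
        · rw [hφ h1]; ext; simp
      have e2 : compDual f ψ = 0 := by
        by_cases h1 : Y.level = X.level
        · rw [hψ (by omega)]; ext; simp
        · rw [hf h1]; ext; simp
      simp [e1, e2]⟩
  id_comp f := by
    refine Subtype.ext (Prod.ext (by simp) ?_)
    ext h
    simp
  comp_id f := by
    refine Subtype.ext (Prod.ext (by simp) ?_)
    ext h
    simp
  assoc f g h := by
    refine Subtype.ext (Prod.ext (by simp) ?_)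
    ext x
    simp [add_assoc]

/-- The component in `C(x, y)` of a morphism `x^[i] ⟶ y^[j]`. -/
def homFst {X Y : Repetition k C} (f : X ⟶ Y) : X.base ⟶ Y.base := f.1.1

/-- The component in `D C(y, x)` of a morphism `x^[i] ⟶ y^[j]`. -/
def homSnd {X Y : Repetition k C} (f : X ⟶ Y) : Module.Dual k (Y.base ⟶ X.base) := f.1.2

theorem homFst_eq_zero {X Y : Repetition k C} (f : X ⟶ Y) (h : Y.level ≠ X.level) :
    homFst f = 0 := f.2.1 h

theorem homSnd_eq_zero {X Y : Repetition k C} (f : X ⟶ Y) (h : Y.level ≠ X.level + 1) :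
    homSnd f = 0 := f.2.2 h

/-- A morphism of the repetition from its two components. -/
def homMk {X Y : Repetition k C} (f : X.base ⟶ Y.base) (φ : Module.Dual k (Y.base ⟶ X.base))
    (hf : Y.level ≠ X.level → f = 0) (hφ : Y.level ≠ X.level + 1 → φ = 0) : X ⟶ Y :=
  ⟨(f, φ), hf, hφ⟩

@[ext] theorem hom_ext {X Y : Repetition k C} {f g : X ⟶ Y} (h1 : homFst f = homFst g)
    (h2 : homSnd f = homSnd g) : f = g := Subtype.ext (Prod.ext h1 h2)

@[simp] theorem homFst_homMk {X Y : Repetition k C} (f : X.base ⟶ Y.base)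
    (φ : Module.Dual k (Y.base ⟶ X.base)) (hf hφ) :
    homFst (homMk (X := X) (Y := Y) f φ hf hφ) = f := rfl
@[simp] theorem homSnd_homMk {X Y : Repetition k C} (f : X.base ⟶ Y.base)
    (φ : Module.Dual k (Y.base ⟶ X.base)) (hf hφ) :
    homSnd (homMk (X := X) (Y := Y) f φ hf hφ) = φ := rfl
@[simp] theorem homFst_id (X : Repetition k C) : homFst (𝟙 X) = 𝟙 X.base := rfl
@[simp] theorem homSnd_id (X : Repetition k C) : homSnd (𝟙 X) = 0 := rfl
@[simp] theorem homFst_comp {X Y Z : Repetition k C} (f : X ⟶ Y) (g : Y ⟶ Z) :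
    homFst (f ≫ g) = homFst f ≫ homFst g := rfl
@[simp] theorem homSnd_comp {X Y Z : Repetition k C} (f : X ⟶ Y) (g : Y ⟶ Z) :
    homSnd (f ≫ g) = dualComp (homSnd f) (homFst g) + compDual (homFst f) (homSnd g) := rfl

instance (X Y : Repetition k C) : AddCommGroup (X ⟶ Y) :=
  inferInstanceAs (AddCommGroup (homSubmodule X Y))
instance (X Y : Repetition k C) : Module k (X ⟶ Y) :=
  inferInstanceAs (Module k (homSubmodule X Y))

@[simp] theorem homFst_add {X Y : Repetition k C} (f g : X ⟶ Y) :
    homFst (f + g) = homFst f + homFst g := rfl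
@[simp] theorem homSnd_add {X Y : Repetition k C} (f g : X ⟶ Y) :
    homSnd (f + g) = homSnd f + homSnd g := rfl
@[simp] theorem homFst_smul {X Y : Repetition k C} (c : k) (f : X ⟶ Y) :
    homFst (c • f) = c • homFst f := rfl
@[simp] theorem homSnd_smul {X Y : Repetition k C} (c : k) (f : X ⟶ Y) :
    homSnd (c • f) = c • homSnd f := rfl

instance : Preadditive (Repetition k C) where
  homGroup X Y := inferInstance
  add_comp X Y Z f f' g := by
    ext
    · simp
    · simp
      abel
  comp_add X Y Z f g g' := by
    ext
    · simp
    · simp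
      abel

instance : Linear k (Repetition k C) where
  homModule X Y := inferInstance
  smul_comp X Y Z c f g := by
    ext <;> simp
  comp_smul X Y Z f c g := by
    ext <;> simp

/-- The automorphism `ν ^ d`, where `ν` is the Nakayama automorphism of the repetition:
`ν x^[i] = x^[i + 1]`, and `ν` is the identity on the components of the morphisms.
This `ν` is the Nakayama automorphism for right modules, `D Ĉ(X, -) ≅ Ĉ(-, ν X)`; the one for left
modules, `D Ĉ(-, X) ≅ Ĉ(ν' X, -)`, is its inverse, which is the case `d = -1`. -/
def nakayama (k : Type u) [Field k] (C : Type w) [Category.{v} C] [Preadditive C] [Linear k C]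
    (d : ℤ) : LinearAut k (Repetition k C) where
  functor :=
    { obj := fun X => ⟨X.base, X.level + d⟩
      map := fun {X Y} f => homMk (X := ⟨X.base, X.level + d⟩) (Y := ⟨Y.base, Y.level + d⟩)
        (homFst (X := X) (Y := Y) f) (homSnd (X := X) (Y := Y) f)
        (fun h => homFst_eq_zero f fun e => h (by simp [e]))
        (fun h => homSnd_eq_zero f fun e => h (by simp only [e]; ring))
      map_id := fun X => rfl
      map_comp := fun f g => rfl }
  map_add f g := rfl
  map_smul c f := rfl
  obj_bijective := by
    refine ⟨fun X Y h => ?_, fun Y => ⟨⟨Y.base, Y.level - d⟩, by simp⟩⟩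
    simp only [Repetition.mk.injEq] at h
    exact Repetition.ext h.1 (by omega)
  map_bijective X Y := by
    let X' : Repetition k C := ⟨X.base, X.level + d⟩
    let Y' : Repetition k C := ⟨Y.base, Y.level + d⟩
    refine ⟨fun f g h => hom_ext (congrArg (homFst (X := X') (Y := Y')) h)
      (congrArg (homSnd (X := X') (Y := Y')) h), fun (f : X' ⟶ Y') => ?_⟩
    exact ⟨homMk (X := X) (Y := Y) (homFst (X := X') (Y := Y') f) (homSnd (X := X') (Y := Y') f)
      (fun h => homFst_eq_zero (X := X') (Y := Y') f fun e => h (by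
        change Y.level + d = X.level + d at e
        omega))
      (fun h => homSnd_eq_zero (X := X') (Y := Y') f fun e => h (by
        change Y.level + d = X.level + d + 1 at e
        omega)), rfl⟩

/-- The canonical extension of an automorphism `φ` of `C` to the repetition: `x^[i] ↦ (φ x)^[i]`;
it is `φ` on `C(x, y)`, and `u ↦ u ∘ φ⁻¹` from `D C(y, x)` to `D C(φ y, φ x)`. -/
noncomputable def hat (φ : LinearAut k C) : LinearAut k (Repetition k C) where
  functor :=
    { obj := fun X => ⟨φ.functor.obj X.base, X.level⟩
      map := fun {X Y} f => homMk (X := ⟨φ.functor.obj X.base, X.level⟩)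
        (Y := ⟨φ.functor.obj Y.base, Y.level⟩)
        (φ.functor.map (homFst f))
        (homSnd f ∘ₗ (φ.homEquiv Y.base X.base).symm.toLinearMap)
        (fun h => by rw [homFst_eq_zero f h, φ.map_zero])
        (fun h => by rw [homSnd_eq_zero f h, LinearMap.zero_comp])
      map_id := fun X => by ext <;> simp
      map_comp := fun {X Y Z} f g => by
        ext h
        · simp
        · obtain ⟨h, rfl⟩ := (φ.homEquiv Z.base X.base).surjective h
          have e1 : φ.functor.map (homFst g) ≫ φ.homEquiv Z.base X.base h =
              φ.homEquiv _ _ (homFst g ≫ h) := by simp [φ.homEquiv_apply]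
          have e2 : φ.homEquiv Z.base X.base h ≫ φ.functor.map (homFst f) =
              φ.homEquiv _ _ (h ≫ homFst f) := by simp [φ.homEquiv_apply]
          simp [e1, e2] }
  map_add f g := by ext <;> simp [φ.map_add]
  map_smul c f := by ext <;> simp [φ.map_smul]
  obj_bijective := by
    refine ⟨fun X Y h => ?_, fun Y => ?_⟩
    · simp only [Repetition.mk.injEq] at h
      exact Repetition.ext (φ.obj_bijective.1 h.1) h.2
    · obtain ⟨x, hx⟩ := φ.obj_bijective.2 Y.base
      exact ⟨⟨x, Y.level⟩, Repetition.ext hx rfl⟩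
  map_bijective X Y := by
    refine ⟨fun f g h => hom_ext ?_ ?_, fun f => ?_⟩
    · exact (φ.map_bijective _ _).1 (congrArg homFst h)
    · have h2 : homSnd f ∘ₗ (φ.homEquiv Y.base X.base).symm.toLinearMap =
        homSnd g ∘ₗ (φ.homEquiv Y.base X.base).symm.toLinearMap := congrArg homSnd h
      ext x
      simpa using LinearMap.congr_fun h2 (φ.homEquiv _ _ x)
    · refine ⟨homMk (X := X) (Y := Y) ((φ.homEquiv _ _).symm (homFst f))
        (homSnd f ∘ₗ (φ.homEquiv Y.base X.base).toLinearMap)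
        (fun h => by rw [homFst_eq_zero f h, _root_.map_zero])
        (fun h => by rw [homSnd_eq_zero f h, LinearMap.zero_comp]), ?_⟩
      refine hom_ext ?_ ?_
      · exact (φ.homEquiv _ _).apply_symm_apply (homFst f)
      · refine LinearMap.ext fun x => ?_
        exact congrArg (homSnd f) ((φ.homEquiv _ _).apply_symm_apply x)

end Repetition

/-- The automorphism `ν ^ d ∘ φ̂` of the repetition of `C`. -/
noncomputable def twist (φ : LinearAut k C) (d : ℤ) : LinearAut k (Repetition k C) :=
  (Repetition.hat φ).comp (Repetition.nakayama k C d)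

/-- The twisted `d`-fold extension of `C` by `φ`: the algebra of the orbit category of the
repetition of `C` by the group generated by `ν ^ d ∘ φ̂`. -/
abbrev TwistedExtension (φ : LinearAut k C) (d : ℤ) : Type (max w u v) :=
  OrbitAlgebra (twist φ d)

/-- The idempotent of the twisted extension at (the orbit of) the object `x = x^[0]` of `C`. -/
noncomputable def vertexIdempotent (φ : LinearAut k C) (d : ℤ) (x : C) : TwistedExtension φ d :=
  OrbitAlgebra.idempotent (twist φ d) ⟨x, 0⟩

end Repetition

/-! ### Path categories and their automorphisms induced by quiver automorphisms -/

section PathAlgebra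

/-- An automorphism of a quiver. -/
structure QuiverAut (V : Type w) [Quiver.{v} V] where
  toPrefunctor : V ⥤q V
  obj_bijective : Function.Bijective toPrefunctor.obj
  map_bijective : ∀ a b : V, Function.Bijective (toPrefunctor.map : (a ⟶ b) → _)

/-- The path algebra `kQ`, as a `k`-linear category: the objects are the vertices, and the
morphisms from `a` to `b` are the formal `k`-linear combinations of paths from `a` to `b`. -/
abbrev PathCategory (k : Type u) [Field k] (V : Type w) [Quiver.{v} V] := Free k (Paths V)

variable {V : Type w} [Quiver.{v} V]

theorem QuiverAut.mapPath_injective (s : QuiverAut V) {a b : V} (p q : Quiver.Path a b)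
    (h : s.toPrefunctor.mapPath p = s.toPrefunctor.mapPath q) : p = q := by
  induction p with
  | nil =>
    cases q with
    | nil => rfl
    | cons q f => simpa using congrArg Quiver.Path.length h
  | @cons b' c p e ih =>
    generalize hq : q = q'
    cases q' with
    | nil => subst hq; simpa using congrArg Quiver.Path.length h
    | @cons b'' _ q' f =>
      subst hq
      simp only [Prefunctor.mapPath_cons, Quiver.Path.cons.injEq] at h
      obtain ⟨h1, h2, h3⟩ := h
      have hb := s.obj_bijective.1 h1
      subst hb
      rw [ih q' (eq_of_heq h2), (s.map_bijective _ _).1 (eq_of_heq h3)]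

theorem QuiverAut.mapPath_surjective (s : QuiverAut V) {a : V} {c : V}
    (p : Quiver.Path (s.toPrefunctor.obj a) c) (b : V) (hb : s.toPrefunctor.obj b = c) :
    ∃ q : Quiver.Path a b, s.toPrefunctor.mapPath q = hb ▸ p := by
  induction p generalizing b with
  | nil =>
    have := s.obj_bijective.1 hb
    subst this
    exact ⟨Quiver.Path.nil, rfl⟩
  | @cons d c p e ih =>
    subst hb
    obtain ⟨d, rfl⟩ := s.obj_bijective.2 d
    obtain ⟨q, hq⟩ := ih d rfl
    obtain ⟨f, rfl⟩ := (s.map_bijective _ _).2 e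
    exact ⟨q.cons f, by simp [hq]⟩

/-- The action of a quiver automorphism on the objects of the path algebra. -/
def QuiverAut.mapObj (k : Type u) [Field k] (s : QuiverAut V) (X : PathCategory k V) :
    PathCategory k V := s.toPrefunctor.obj X

/-- The linear extension of a quiver automorphism to the linear combinations of paths. -/
noncomputable def QuiverAut.mapHom (k : Type u) [Field k] (s : QuiverAut V)
    (X Y : PathCategory k V) (f : X ⟶ Y) :
    s.mapObj k X ⟶ s.mapObj k Y :=
  Finsupp.mapDomain (M := k) (fun p : Quiver.Path (V := V) X Y => s.toPrefunctor.mapPath p) f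

theorem QuiverAut.mapHom_single (k : Type u) [Field k] (s : QuiverAut V)
    (X Y : PathCategory k V) (p : Quiver.Path (V := V) X Y) (c : k) :
    s.mapHom k X Y (Finsupp.single p c) = Finsupp.single (s.toPrefunctor.mapPath p) c :=
  Finsupp.mapDomain_single

theorem QuiverAut.mapHom_add (k : Type u) [Field k] (s : QuiverAut V)
    (X Y : PathCategory k V) (f g : X ⟶ Y) :
    s.mapHom k X Y (f + g) = s.mapHom k X Y f + s.mapHom k X Y g :=
  Finsupp.mapDomain_add

theorem QuiverAut.mapHom_zero (k : Type u) [Field k] (s : QuiverAut V)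
    (X Y : PathCategory k V) : s.mapHom k X Y 0 = 0 :=
  Finsupp.mapDomain_zero

theorem QuiverAut.mapHom_comp (k : Type u) [Field k] (s : QuiverAut V)
    (X Y Z : PathCategory k V) (f : X ⟶ Y) (g : Y ⟶ Z) :
    s.mapHom k X Z (f ≫ g) = s.mapHom k X Y f ≫ s.mapHom k Y Z g := by
  refine Finsupp.induction_linear (M := k) f ?_ ?_ ?_
  · refine (congrArg (s.mapHom k X Z) Limits.zero_comp).trans ?_
    refine (s.mapHom_zero k X Z).trans ?_
    refine ((Limits.zero_comp (X := s.mapObj k X) (Y := s.mapObj k Y)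
      (f := s.mapHom k Y Z g)).symm.trans ?_)
    exact congrArg (· ≫ s.mapHom k Y Z g) (s.mapHom_zero k X Y).symm
  · intro f₁ f₂ h₁ h₂
    refine (congrArg (s.mapHom k X Z) (Preadditive.add_comp X Y Z f₁ f₂ g)).trans ?_
    refine (s.mapHom_add k X Z _ _).trans ?_
    rw [h₁, h₂, ← Preadditive.add_comp]
    exact congrArg (· ≫ s.mapHom k Y Z g) (s.mapHom_add k X Y f₁ f₂).symm
  · intro p c
    refine Finsupp.induction_linear (M := k) g ?_ ?_ ?_
    · refine (congrArg (s.mapHom k X Z) Limits.comp_zero).trans ?_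
      refine (s.mapHom_zero k X Z).trans ?_
      refine ((Limits.comp_zero (Y := s.mapObj k Y) (Z := s.mapObj k Z)
        (f := s.mapHom k X Y (Finsupp.single p c))).symm.trans ?_)
      exact congrArg (s.mapHom k X Y _ ≫ ·) (s.mapHom_zero k Y Z).symm
    · intro g₁ g₂ h₁ h₂
      refine (congrArg (s.mapHom k X Z) (Preadditive.comp_add X Y Z _ g₁ g₂)).trans ?_
      refine (s.mapHom_add k X Z _ _).trans ?_
      rw [h₁, h₂, ← Preadditive.comp_add]
      exact congrArg (s.mapHom k X Y _ ≫ ·) (s.mapHom_add k Y Z g₁ g₂).symm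
    · intro q d
      refine (congrArg (s.mapHom k X Z) (Free.single_comp_single k (C := Paths V) p q c d)).trans ?_
      refine (s.mapHom_single k X Z _ _).trans ?_
      have e : s.toPrefunctor.mapPath (Quiver.Path.comp (V := V) p q) =
          (s.toPrefunctor.mapPath p).comp (s.toPrefunctor.mapPath q) :=
        s.toPrefunctor.mapPath_comp p q
      refine (congrArg (fun z => Finsupp.single z (c * d)) e).trans ?_
      refine (Free.single_comp_single k (C := Paths V) (s.toPrefunctor.mapPath p)
        (s.toPrefunctor.mapPath q) c d).symm.trans ?_
      exact congrArg₂ (fun a b => a ≫ b) (s.mapHom_single k X Y p c).symm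
        (s.mapHom_single k Y Z q d).symm

/-- The linearization of a quiver automorphism, an automorphism of the path algebra. -/
noncomputable def QuiverAut.linearize (k : Type u) [Field k] (s : QuiverAut V) :
    LinearAut k (PathCategory k V) where
  functor :=
    { obj := s.mapObj k
      map := fun {X Y} f => s.mapHom k X Y f
      map_id := fun X => s.mapHom_single k X X Quiver.Path.nil 1
      map_comp := fun {X Y Z} f g => s.mapHom_comp k X Y Z f g }
  map_add {X Y} f g := s.mapHom_add k X Y f g
  map_smul c f := Finsupp.mapDomain_smul c f
  obj_bijective := s.obj_bijective
  map_bijective X Y := by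
    have hb : Function.Bijective (fun p : Quiver.Path (V := V) X Y => s.toPrefunctor.mapPath p) :=
      ⟨s.mapPath_injective, fun p => s.mapPath_surjective p Y rfl⟩
    exact ⟨Finsupp.mapDomain_injective hb.1, Finsupp.mapDomain_surjective hb.2⟩

end PathAlgebra

/-! ### The quiver of a permutation with an enumeration of its cycles -/

/-- A decomposition `σ = (x₁₁ x₁₂ ⋯ x₁ₜ₍₁₎) ⋯ (xₘ₁ xₘ₂ ⋯ xₘₜ₍ₘ₎)` into disjoint cycles of
lengths `t i ≥ 1` whose union is the whole set: `x ⟨i, j⟩` is the `j`-th entry of the `i`-th cycle,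
and `finRotate` is `j ↦ j + 1` modulo `t i`. All indices start from `0`. -/
structure CycleDecomposition {n : ℕ} (σ : Equiv.Perm (Fin n)) where
  m : ℕ
  t : Fin m → ℕ
  t_pos : ∀ i, 0 < t i
  x : (Σ i : Fin m, Fin (t i)) ≃ Fin n
  map_x : ∀ (i : Fin m) (j : Fin (t i)), σ (x ⟨i, j⟩) = x ⟨i, finRotate (t i) j⟩

/-- Every permutation has such a decomposition. -/
theorem CycleDecomposition.nonempty {n : ℕ} (σ : Equiv.Perm (Fin n)) :
    Nonempty (CycleDecomposition σ) := by
  classical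
  let e := (Fintype.equivFin (Quotient (Equiv.Perm.SameCycle.setoid σ))).symm
  let r : Fin _ → Fin n := fun i => (e i).out
  have hpos : ∀ a : Fin n, 0 < Function.minimalPeriod σ a := fun a =>
    Function.minimalPeriod_pos_of_mem_periodicPts
      (Function.Injective.mem_periodicPts σ.injective a)
  have hr : ∀ i, Quotient.mk (Equiv.Perm.SameCycle.setoid σ) (r i) = e i := fun i =>
    Quotient.out_eq _
  let f : (Σ i, Fin (Function.minimalPeriod σ (r i))) → Fin n := fun p => σ^[(p.2 : ℕ)] (r p.1)
  have hq : ∀ p, Quotient.mk (Equiv.Perm.SameCycle.setoid σ) (f p) = e p.1 := fun p => by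
    rw [← hr]
    refine Quotient.sound (show σ.SameCycle _ _ from Equiv.Perm.SameCycle.symm ⟨(p.2 : ℕ), ?_⟩)
    simp only [f, zpow_natCast, ← Equiv.Perm.iterate_eq_pow]
  have hf : Function.Bijective f := by
    constructor
    · intro p q h
      obtain ⟨i, j⟩ := p
      obtain ⟨i', j'⟩ := q
      have hi : i = i' := e.injective (by rw [← hq ⟨i, j⟩, h, hq])
      subst hi
      have := Function.iterate_injOn_Iio_minimalPeriod (f := σ) (x := r i) j.2 j'.2 h
      rw [Fin.ext this]
    · intro y
      obtain ⟨i, hi⟩ := e.surjective (Quotient.mk _ y)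
      have h1 : σ.SameCycle (r i) y := Quotient.exact ((hr i).trans hi)
      obtain ⟨m, hm⟩ := h1.exists_nat_pow_eq
      refine ⟨⟨i, ⟨m % _, Nat.mod_lt _ (hpos _)⟩⟩, ?_⟩
      simp only [f, Function.iterate_mod_minimalPeriod_eq]
      rw [Equiv.Perm.iterate_eq_pow, hm]
  refine ⟨⟨_, fun i => Function.minimalPeriod σ (r i), fun i => hpos _, Equiv.ofBijective f hf,
    fun i j => ?_⟩⟩
  change σ (σ^[(j : ℕ)] (r i)) = σ^[(finRotate _ j : ℕ)] (r i)
  rw [← Function.iterate_succ_apply' σ]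
  have key : ∀ (T : ℕ) (hT : σ^[T] (r i) = r i) (j : Fin T),
      σ^[(j : ℕ).succ] (r i) = σ^[(finRotate T j : ℕ)] (r i) := by
    intro T hT j
    cases T with
    | zero => exact j.elim0
    | succ T =>
      rw [coe_finRotate]
      split_ifs with h
      · subst h
        simpa using hT
      · rfl
  exact key _ (Function.iterate_minimalPeriod) j

section CycleQuiver

variable {n : ℕ} {σ : Equiv.Perm (Fin n)}

/-- The vertices of the quiver: the pairs `⟨i, j⟩`, standing for `x ⟨i, j⟩ ∈ {1, …, n}`. -/
def CycleDecomposition.Vertex (D : CycleDecomposition σ) : Type := Σ i : Fin D.m, Fin (D.t i)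

/-- The vertex corresponding to an element of `{1, …, n}`. -/
def CycleDecomposition.vertex (D : CycleDecomposition σ) (a : Fin n) : D.Vertex := D.x.symm a

/-- The arrows between the vertices of the consecutive cycles `i` and `i' = i + 1`: one arrow
`α i j l : ⟨i, j⟩ ⟶ ⟨i + 1, l⟩` for all `j`, `l` if the cycle `i` is the first, third, fifth, …
one, and one arrow `β i j l : ⟨i + 1, l⟩ ⟶ ⟨i, j⟩` for all `j`, `l` if it is the second, fourth, …
one (the indices `i` start from `0`, which exchanges `Even` and `Odd`). -/
inductive CycleDecomposition.Arrow (D : CycleDecomposition σ) : D.Vertex → D.Vertex → Type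
  | alpha {i i' : Fin D.m} (hi' : (i : ℕ) + 1 = i') (hi : Even (i : ℕ)) (j : Fin (D.t i))
      (l : Fin (D.t i')) : D.Arrow ⟨i, j⟩ ⟨i', l⟩
  | beta {i i' : Fin D.m} (hi' : (i : ℕ) + 1 = i') (hi : Odd (i : ℕ)) (j : Fin (D.t i))
      (l : Fin (D.t i')) : D.Arrow ⟨i', l⟩ ⟨i, j⟩

instance (D : CycleDecomposition σ) : Quiver.{0} D.Vertex := ⟨D.Arrow⟩

theorem CycleDecomposition.arrow_iff (D : CycleDecomposition σ) (a b : D.Vertex) :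
    Nonempty (a ⟶ b) ↔ ((a.1 : ℕ) + 1 = b.1 ∧ Even (a.1 : ℕ)) ∨
      ((b.1 : ℕ) + 1 = a.1 ∧ Odd (b.1 : ℕ)) := by
  constructor
  · rintro ⟨(f : D.Arrow a b)⟩
    cases f with
    | alpha hi' hi j l => exact .inl ⟨hi', hi⟩
    | beta hi' hi j l => exact .inr ⟨hi', hi⟩
  · obtain ⟨i, j⟩ := a
    obtain ⟨i', l⟩ := b
    rintro (⟨h1, h2⟩ | ⟨h1, h2⟩)
    · exact ⟨.alpha h1 h2 j l⟩
    · exact ⟨.beta h1 h2 l j⟩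

/-- There is at most one arrow between two vertices, so a permutation of the vertices extends
in at most one way to an automorphism of the quiver. -/
instance (D : CycleDecomposition σ) (a b : D.Vertex) : Subsingleton (a ⟶ b) := by
  refine ⟨fun (f g : D.Arrow a b) => ?_⟩
  cases f with
  | alpha hi' hi j l =>
    cases g with
    | alpha => rfl
    | beta => omega
  | beta hi' hi j l =>
    cases g with
    | alpha => omega
    | beta => rfl

/-- The automorphism of the quiver which is `σ` on the vertices. -/
def CycleDecomposition.quiverAut (D : CycleDecomposition σ) : QuiverAut D.Vertex where
  toPrefunctor :=
    { obj := fun a => ⟨a.1, finRotate (D.t a.1) a.2⟩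
      map := fun {a b} (f : D.Arrow a b) => match f with
        | .alpha hi' hi j l => .alpha hi' hi (finRotate _ j) (finRotate _ l)
        | .beta hi' hi j l => .beta hi' hi (finRotate _ j) (finRotate _ l) }
  obj_bijective := (Equiv.sigmaCongrRight fun i => finRotate (D.t i)).bijective
  map_bijective a b := by
    refine ⟨fun f g _ => Subsingleton.elim f g, fun g => ?_⟩
    suffices h : Nonempty (a ⟶ b) from ⟨h.some, Subsingleton.elim _ _⟩
    exact (D.arrow_iff a b).2 ((D.arrow_iff ⟨a.1, finRotate _ a.2⟩
      ⟨b.1, finRotate _ b.2⟩).1 ⟨g⟩)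

/-- The action of `quiverAut` on the vertices is `σ` under the identification of the vertices
with `{1, …, n}`. -/
theorem CycleDecomposition.x_quiverAut (D : CycleDecomposition σ) (a : D.Vertex) :
    D.x (D.quiverAut.toPrefunctor.obj a) = σ (D.x a) := (D.map_x a.1 a.2).symm

/-- `σ` as an automorphism of the path algebra of the quiver. -/
noncomputable def CycleDecomposition.pathAut (D : CycleDecomposition σ) (k : Type u) [Field k] :
    LinearAut k (PathCategory k D.Vertex) := D.quiverAut.linearize k

/-- The twisted `d`-fold extension of the path algebra of the quiver by `σ`: the twisted `1`-fold
extension for `d = 1`, and its analogue with `ν⁻¹` in place of `ν` for `d = -1`. -/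
abbrev CycleDecomposition.Extension (D : CycleDecomposition σ) (k : Type u) [Field k] (d : ℤ) :
    Type u := TwistedExtension (D.pathAut k) d

/-- The idempotents of the twisted extension, indexed by `{1, …, n}`. -/
noncomputable def CycleDecomposition.idempotent (D : CycleDecomposition σ) (k : Type u) [Field k]
    (d : ℤ) (a : Fin n) : D.Extension k d :=
  vertexIdempotent (D.pathAut k) d (D.vertex a : PathCategory k D.Vertex)

end CycleQuiver

/-! ### Self-injective algebras and Nakayama permutations -/

section Nakayama

/-- The socle of a module: the sum of its simple submodules. -/
def socle (R M : Type*) [Ring R] [AddCommGroup M] [Module R M] : Submodule R M :=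
  sSup {S : Submodule R M | IsSimpleModule R S}

/-- The top of a module: its quotient by its radical. -/
abbrev Top (R M : Type*) [Ring R] [AddCommGroup M] [Module R M] : Type _ :=
  M ⧸ Module.jacobson R M

/-- A self-injective algebra over a field: a finite-dimensional algebra that is injective as a
left and as a right module over itself. -/
structure IsSelfInjectiveAlgebra (k : Type*) (A : Type*) [Field k] [Ring A] [Algebra k A] :
    Prop where
  finite : Module.Finite k A
  left : Module.Injective A A
  right : Module.Injective Aᵐᵒᵖ A

variable {A : Type*} [Ring A]

/-- The left ideal `A e`. -/
abbrev leftProj (e : A) : Submodule A A := Submodule.span A {e}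

/-- The right ideal `e A`, as a right `A`-module. -/
abbrev rightProj (e : A) : Submodule Aᵐᵒᵖ A := Submodule.span Aᵐᵒᵖ {e}

/-- A complete system of orthogonal primitive idempotents whose projective modules are pairwise
nonisomorphic; a ring with such a system is basic. -/
structure IsBasicSystem {ι : Type*} [Fintype ι] (e : ι → A) : Prop where
  complete : CompleteOrthogonalIdempotents e
  ne_zero : ∀ i, e i ≠ 0
  primitive : ∀ i (f g : A), IsIdempotentElem f → IsIdempotentElem g → f * g = 0 → g * f = 0 →
    e i = f + g → f = 0 ∨ g = 0
  not_iso : ∀ i j, Nonempty (rightProj (e i) ≃ₗ[Aᵐᵒᵖ] rightProj (e j)) → i = j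

/-- `π` is the Nakayama permutation, for right modules: `soc (e_i A) ≅ top (e_{π i} A)`. -/
def IsNakayamaPermutation {ι : Type*} (e : ι → A) (π : Equiv.Perm ι) : Prop :=
  ∀ i, Nonempty (socle Aᵐᵒᵖ (rightProj (e i)) ≃ₗ[Aᵐᵒᵖ] Top Aᵐᵒᵖ (rightProj (e (π i))))

/-- `π` is the Nakayama permutation, for left modules: `soc (A e_i) ≅ top (A e_{π i})`. -/
def IsLeftNakayamaPermutation {ι : Type*} (e : ι → A) (π : Equiv.Perm ι) : Prop :=
  ∀ i, Nonempty (socle A (leftProj (e i)) ≃ₗ[A] Top A (leftProj (e (π i))))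

end Nakayama

end TwistedExt

/-!
The repetition carries a nondegenerate trace pairing `Ĉ(X, Y) × Ĉ(Y, νX) → k`, evaluation of the
component in `D C(x, x)` at `𝟙 x`. Summing it over the objects gives a functional `λ` on the orbit
algebra for which `λ(ba)` is nondegenerate, so the algebra is Frobenius, hence self-injective; and
`λ(e_x a) = λ(a e_y)` where `y^[1]` lies in the orbit of `x^[0]`.

Every path of the quiver has length at most one. So radical morphisms of `C` compose to zero, three
radical morphisms of `Ĉ` compose to zero, and `A / rad A` is a product of copies of `k`, with
characters `χ_x`. If `w` represents `χ_x` in the sense that `λ(bw) = χ_x(b)`, then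
`λ(e_x a) = λ(a e_y)` puts `w` into `A e_y`, and `w` spans the socle of `A e_y`, on which `A` acts
through `χ_x`. Right modules are treated as left modules over the opposite algebra.
-/

namespace TwistedExt

/-! ### Frobenius forms and Nakayama permutations -/

section Modules

variable {R M N : Type*} [Ring R] [AddCommGroup M] [Module R M] [AddCommGroup N] [Module R N]

theorem smul_eq_zero_of_mem_jacobson_of_mem_socle {r : R} {m : M} (hr : r ∈ Ring.jacobson R)
    (hm : m ∈ socle R M) : r • m = 0 := by
  rw [socle, sSup_eq_iSup'] at hm
  refine Submodule.iSup_induction _ (motive := fun x => r • x = 0) hm ?_ (smul_zero r) ?_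
  · rintro ⟨S, hS : IsSimpleModule R S⟩ x hx
    exact congrArg Subtype.val
      (Module.mem_annihilator.1 (IsSemisimpleModule.jacobson_le_annihilator R S hr) ⟨x, hx⟩)
  · intro x y hx hy
    rw [smul_add, hx, hy, add_zero]

theorem map_socle_le (φ : M ≃ₗ[R] N) : (socle R M).map (φ : M →ₗ[R] N) ≤ socle R N := by
  rw [Submodule.map_le_iff_le_comap]
  refine sSup_le fun S (hS : IsSimpleModule R S) => ?_
  rw [← Submodule.map_le_iff_le_comap]
  exact le_sSup (IsSimpleModule.congr (φ.submoduleMap S).symm)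

theorem map_socle (φ : M ≃ₗ[R] N) : (socle R M).map (φ : M →ₗ[R] N) = socle R N := by
  refine (map_socle_le φ).antisymm ?_
  have h := Submodule.map_mono (f := (φ : M →ₗ[R] N)) (map_socle_le φ.symm)
  rwa [← Submodule.map_comp, LinearEquiv.comp_coe, LinearEquiv.symm_trans_self,
    LinearEquiv.refl_toLinearMap, Submodule.map_id] at h

theorem nonempty_socle_equiv (φ : M ≃ₗ[R] N) : Nonempty (socle R M ≃ₗ[R] socle R N) :=
  ⟨(φ.submoduleMap _).trans (LinearEquiv.ofEq _ _ (map_socle φ))⟩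

theorem nonempty_top_equiv (φ : M ≃ₗ[R] N) : Nonempty (Top R M ≃ₗ[R] Top R N) :=
  ⟨Submodule.Quotient.equiv _ _ φ (Module.map_jacobson_of_bijective φ.bijective)⟩

theorem nonempty_top_equiv_of_surjective [IsSimpleModule R N] {f : M →ₗ[R] N}
    (hf : Function.Surjective f) (hker : LinearMap.ker f ≤ Module.jacobson R M) :
    Nonempty (Top R M ≃ₗ[R] N) :=
  have hker' := (IsSemisimpleModule.jacobson_le_ker R R M N f).antisymm hker
  ⟨(Submodule.quotEquivOfEq _ _ hker').trans (f.quotKerEquivOfSurjective hf)⟩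

end Modules

section Idempotents

variable {A : Type*} [Ring A]

theorem mem_leftProj_iff {e : A} (he : IsIdempotentElem e) {a : A} :
    a ∈ leftProj e ↔ a * e = a := by
  refine Submodule.mem_span_singleton.trans ⟨?_, fun h => ⟨a, h⟩⟩
  rintro ⟨b, rfl⟩
  rw [smul_eq_mul, mul_assoc, he.eq]

theorem completeOrthogonalIdempotents_op {ι : Type*} [Fintype ι] {e : ι → A}
    (h : CompleteOrthogonalIdempotents e) :
    CompleteOrthogonalIdempotents fun i => MulOpposite.op (e i) where
  idem i := congrArg MulOpposite.op (h.idem i)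
  ortho _ _ hij := congrArg MulOpposite.op (h.ortho hij.symm)
  complete := by rw [← Finset.op_sum, h.complete, MulOpposite.op_one]

/-- The regular right module as a left module over the opposite ring. -/
def opRegularEquiv (A : Type*) [Ring A] : A ≃ₗ[Aᵐᵒᵖ] Aᵐᵒᵖ where
  toAddEquiv := MulOpposite.opAddEquiv
  map_smul' _ _ := rfl

/-- The right ideal `e A` of `A` as a left ideal of the opposite ring. -/
def rightProjEquiv (e : A) : rightProj e ≃ₗ[Aᵐᵒᵖ] leftProj (MulOpposite.op e) :=
  ((opRegularEquiv A).submoduleMap _).trans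
    (LinearEquiv.ofEq _ _ (by rw [Submodule.map_span, Set.image_singleton]; rfl))

end Idempotents

section FrobeniusForm

variable {k A : Type*} [Field k] [Ring A] [Algebra k A]

/-- A functional `lam` on an algebra is a Frobenius form if the bilinear form `lam (b * a)` is
nondegenerate in `a`; in finite dimension it is then nondegenerate in `b` as well. -/
def IsFrobeniusForm (lam : Module.Dual k A) : Prop := ∀ a, (∀ b, lam (b * a) = 0) → a = 0

namespace IsFrobeniusForm

variable {lam : Module.Dual k A}

theorem eq_of_forall_apply_mul_eq (h : IsFrobeniusForm lam) {a a' : A}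
    (haa' : ∀ b, lam (b * a) = lam (b * a')) : a = a' :=
  sub_eq_zero.1 (h _ fun b => by rw [mul_sub, map_sub, haa', sub_self])

variable [FiniteDimensional k A]

theorem exists_forall_apply_mul_eq (h : IsFrobeniusForm lam) (g : Module.Dual k A) :
    ∃ a, ∀ b, lam (b * a) = g b := by
  let T : A →ₗ[k] Module.Dual k A := ((LinearMap.mul k A).compr₂ lam).flip
  have hinj : Function.Injective T :=
    LinearMap.ker_eq_bot.1 (LinearMap.ker_eq_bot'.2 fun a ha => h a (LinearMap.congr_fun ha))
  obtain ⟨a, ha⟩ := (LinearMap.injective_iff_surjective_of_finrank_eq_finrank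
    Subspace.dual_finrank_eq.symm).1 hinj g
  exact ⟨a, LinearMap.congr_fun ha⟩

theorem op (h : IsFrobeniusForm lam) :
    IsFrobeniusForm (lam ∘ₗ (MulOpposite.opLinearEquiv k : A ≃ₗ[k] Aᵐᵒᵖ).symm.toLinearMap) := by
  intro a ha
  refine MulOpposite.unop_injective ((Module.forall_dual_apply_eq_zero_iff k _).1 fun g => ?_)
  obtain ⟨b, hb⟩ := h.exists_forall_apply_mul_eq g
  rw [← hb]
  exact ha (MulOpposite.op b)

theorem injective_self (h : IsFrobeniusForm lam) : Module.Injective A A := by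
  refine Module.Baer.injective fun I g => ?_
  obtain ⟨g', hg'⟩ := LinearMap.exists_extend (p := I.restrictScalars k)
    (lam ∘ₗ (g.restrictScalars k : I.restrictScalars k →ₗ[k] A))
  obtain ⟨a, ha⟩ := h.exists_forall_apply_mul_eq g'
  refine ⟨LinearMap.toSpanSingleton A A a, fun x hx => h.eq_of_forall_apply_mul_eq fun b => ?_⟩
  calc lam (b * (x * a)) = g' (b * x) := by rw [← mul_assoc, ha]
    _ = lam (g (b • ⟨x, hx⟩)) := LinearMap.congr_fun hg' ⟨b * x, I.mul_mem_left b hx⟩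
    _ = lam (b * g ⟨x, hx⟩) := by rw [map_smul, smul_eq_mul]

theorem isSelfInjectiveAlgebra (h : IsFrobeniusForm lam) : IsSelfInjectiveAlgebra k A where
  finite := inferInstance
  left := h.injective_self
  right := Module.Baer.injective
    (Module.Baer.of_equiv (opRegularEquiv A).symm (Module.Baer.of_injective h.op.injective_self))

end IsFrobeniusForm

end FrobeniusForm

section Characters

variable {k A : Type*} [Field k] [Ring A] [Algebra k A]

theorem isMaximal_ker (χ : A →ₐ[k] k) : (RingHom.ker χ).IsMaximal :=
  RingHom.ker_isMaximal_of_surjective χ fun c => ⟨algebraMap k A c, χ.commutes c⟩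

theorem isSimpleModule_quotient_ker (χ : A →ₐ[k] k) : IsSimpleModule A (A ⧸ RingHom.ker χ) :=
  isSimpleModule_iff_isCoatom.2 (isMaximal_ker χ).out

end Characters

/-- A complete system of orthogonal idempotents `e i` of an algebra over `k` which is *split basic*:
there are characters `χ i` with `χ i (e i) = 1`, and their common kernel consists of nilpotent
elements (so that it is the radical, with quotient `k × ⋯ × k`). -/
structure IsSplitBasicSystem {k A ι : Type*} [Field k] [Ring A] [Algebra k A] [Fintype ι]
    (e : ι → A) (χ : ι → A →ₐ[k] k) : Prop where
  complete : CompleteOrthogonalIdempotents e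
  char_self : ∀ i, χ i (e i) = 1
  isNilpotent : ∀ a, (∀ i, χ i a = 0) → IsNilpotent a

namespace IsSplitBasicSystem

variable {k A ι : Type*} [Field k] [Ring A] [Algebra k A] [Fintype ι] {e : ι → A}
  {χ : ι → A →ₐ[k] k}

theorem char_of_ne (h : IsSplitBasicSystem e χ) {i j : ι} (hij : i ≠ j) : χ i (e j) = 0 := by
  simpa only [map_mul, map_zero, h.char_self, one_mul] using
    congrArg (χ i) (h.complete.ortho hij)

theorem mem_jacobson_iff (h : IsSplitBasicSystem e χ) {a : A} :
    a ∈ Ring.jacobson A ↔ ∀ i, χ i a = 0 := by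
  refine ⟨fun ha i => ?_, fun ha => ?_⟩
  · have := isMaximal_ker (χ i)
    exact Ring.jacobson_le_of_isMaximal (RingHom.ker (χ i)) ha
  rw [Ring.jacobson_eq_sInf_isMaximal, Ideal.mem_sInf]
  intro I hI
  by_contra haI
  obtain ⟨b, y, hy, hb⟩ := hI.exists_inv haI
  have hunit : IsUnit (1 - b * a) :=
    (h.isNilpotent _ fun i => by rw [map_mul, ha, mul_zero]).isUnit_one_sub
  rw [← hb, add_sub_cancel_left] at hunit
  exact hI.ne_top (I.eq_top_of_isUnit_mem hy hunit)

theorem jacobson_pow_three_eq_bot (h : IsSplitBasicSystem e χ)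
    (hmul : ∀ a b c, (∀ i, χ i a = 0) → (∀ i, χ i b = 0) → (∀ i, χ i c = 0) → a * b * c = 0) :
    Ring.jacobson A ^ 3 = ⊥ := by
  rw [Submodule.pow_succ, Submodule.pow_succ, Submodule.pow_one, eq_bot_iff, Ideal.mul_le]
  intro x hx c hc
  suffices hsq : Ring.jacobson A * Ring.jacobson A ≤
      LinearMap.ker (LinearMap.toSpanSingleton A A c) from hsq hx
  refine Ideal.mul_le.2 fun a ha b hb => ?_
  exact hmul a b c (h.mem_jacobson_iff.1 ha) (h.mem_jacobson_iff.1 hb) (h.mem_jacobson_iff.1 hc)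

theorem op (h : IsSplitBasicSystem e χ) :
    IsSplitBasicSystem (fun i => MulOpposite.op (e i))
      (fun i => (χ i).fromOpposite fun _ _ => Commute.all _ _) where
  complete := completeOrthogonalIdempotents_op h.complete
  char_self := h.char_self
  isNilpotent a ha := (h.isNilpotent a.unop ha).imp fun _ hn => congrArg MulOpposite.op hn

theorem eq_of_nonempty_quotient_ker_equiv (h : IsSplitBasicSystem e χ) {i j : ι}
    (hij : Nonempty ((A ⧸ RingHom.ker (χ i)) ≃ₗ[A] A ⧸ RingHom.ker (χ j))) : i = j := by
  obtain ⟨φ⟩ := hij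
  by_contra hne
  obtain ⟨b, hb⟩ := Submodule.Quotient.mk_surjective _ (φ (Submodule.Quotient.mk 1))
  have hkill : φ (Submodule.Quotient.mk (e i)) = 0 := by
    rw [← mul_one (e i), ← smul_eq_mul, Submodule.Quotient.mk_smul, map_smul, ← hb,
      ← Submodule.Quotient.mk_smul, Submodule.Quotient.mk_eq_zero, RingHom.mem_ker, smul_eq_mul,
      map_mul, h.char_of_ne (Ne.symm hne), zero_mul]
  rw [LinearEquiv.map_eq_zero_iff, Submodule.Quotient.mk_eq_zero, RingHom.mem_ker,
    h.char_self] at hkill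
  exact one_ne_zero hkill

theorem nonempty_top_leftProj_equiv (h : IsSplitBasicSystem e χ) (i : ι) :
    Nonempty (Top A (leftProj (e i)) ≃ₗ[A] A ⧸ RingHom.ker (χ i)) := by
  have := isSimpleModule_quotient_ker (χ i)
  have hei : e i ∈ leftProj (e i) := Submodule.mem_span_singleton_self _
  let f : leftProj (e i) →ₗ[A] A ⧸ RingHom.ker (χ i) :=
    (RingHom.ker (χ i)).mkQ ∘ₗ (leftProj (e i)).subtype
  refine nonempty_top_equiv_of_surjective (f := f) (fun q => ?_) fun x hx => ?_
  · obtain ⟨a, rfl⟩ := Submodule.Quotient.mk_surjective _ q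
    refine ⟨a • ⟨e i, hei⟩, (Submodule.Quotient.eq _).2 (RingHom.mem_ker.2 ?_)⟩
    rw [map_sub, Submodule.subtype_apply, Submodule.coe_smul, smul_eq_mul, map_mul, h.char_self,
      mul_one, sub_self]
  · have hxi : χ i x = 0 := RingHom.mem_ker.1 ((Submodule.Quotient.mk_eq_zero _).1 hx)
    have hxe : (x : A) * e i = x := (mem_leftProj_iff (h.complete.idem i)).1 x.2
    have hxJ : (x : A) ∈ Ring.jacobson A := by
      refine h.mem_jacobson_iff.2 fun j => ?_
      rcases eq_or_ne j i with rfl | hji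
      · exact hxi
      · rw [← hxe, map_mul, h.char_of_ne hji, mul_zero]
    have hx' : x = (x : A) • ⟨e i, hei⟩ := Subtype.ext hxe.symm
    rw [hx']
    exact Ring.jacobson_smul_top_le _ _ (Submodule.smul_mem_smul hxJ Submodule.mem_top)

theorem eq_of_nonempty_leftProj_equiv (h : IsSplitBasicSystem e χ) {i j : ι}
    (hij : Nonempty (leftProj (e i) ≃ₗ[A] leftProj (e j))) : i = j := by
  obtain ⟨φ⟩ := hij
  obtain ⟨φt⟩ := nonempty_top_equiv φ
  obtain ⟨φi⟩ := h.nonempty_top_leftProj_equiv i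
  obtain ⟨φj⟩ := h.nonempty_top_leftProj_equiv j
  exact h.eq_of_nonempty_quotient_ker_equiv ⟨(φi.symm.trans φt).trans φj⟩

theorem eq_zero_of_char_eq_zero (h : IsSplitBasicSystem e χ) {i : ι} {f : A}
    (hf : IsIdempotentElem f) (hfe : f * e i = f) (hfi : χ i f = 0) : f = 0 := by
  refine hf.eq_zero_of_isNilpotent (h.isNilpotent f fun j => ?_)
  rcases eq_or_ne j i with rfl | hji
  · exact hfi
  · rw [← hfe, map_mul, h.char_of_ne hji, mul_zero]

theorem eq_zero_or_eq_zero_of_eq_add (h : IsSplitBasicSystem e χ) {i : ι} {f g : A}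
    (hf : IsIdempotentElem f) (hg : IsIdempotentElem g) (hfg : f * g = 0) (hgf : g * f = 0)
    (hi : e i = f + g) : f = 0 ∨ g = 0 := by
  have hχ : χ i f * χ i g = 0 := by rw [← map_mul, hfg, map_zero]
  refine (mul_eq_zero.1 hχ).imp (h.eq_zero_of_char_eq_zero hf ?_) (h.eq_zero_of_char_eq_zero hg ?_)
  · rw [hi, mul_add, hf.eq, hfg, add_zero]
  · rw [hi, mul_add, hg.eq, hgf, zero_add]

theorem isBasicSystem (h : IsSplitBasicSystem e χ) : IsBasicSystem e where
  complete := h.complete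
  ne_zero i hi := zero_ne_one (α := k) (by rw [← h.char_self i, hi, map_zero])
  primitive _ _ _ hf hg hfg hgf hi := h.eq_zero_or_eq_zero_of_eq_add hf hg hfg hgf hi
  not_iso i j := by
    rintro ⟨φ⟩
    exact h.op.eq_of_nonempty_leftProj_equiv
      ⟨((rightProjEquiv (e i)).symm.trans φ).trans (rightProjEquiv (e j))⟩

end IsSplitBasicSystem

section NakayamaPermutation

variable {k A ι : Type*} [Field k] [Ring A] [Algebra k A] [Fintype ι] {e : ι → A}
  {χ : ι → A →ₐ[k] k} {lam : Module.Dual k A} {i j : ι}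

theorem IsSplitBasicSystem.eq_smul_of_mem_socle (h : IsSplitBasicSystem e χ)
    (hlam : IsFrobeniusForm lam) (hij : ∀ a, lam (e i * a) = lam (a * e j)) {w : A}
    (hw : ∀ b, lam (b * w) = χ i b) {s : leftProj (e j)} (hs : s ∈ socle A (leftProj (e j))) :
    (s : A) = lam s • w := by
  have hse : (s : A) * e j = s := (mem_leftProj_iff (h.complete.idem j)).1 s.2
  have hrad : ∀ c, (∀ l, χ l c = 0) → c * (s : A) = 0 := fun c hc =>
    congrArg Subtype.val
      (smul_eq_zero_of_mem_jacobson_of_mem_socle (h.mem_jacobson_iff.2 hc) hs)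
  refine hlam.eq_of_forall_apply_mul_eq fun b => ?_
  -- `e i * b` and `χ i b • e i` agree modulo the radical, which annihilates the socle.
  have hb : (e i * b - χ i b • e i) * (s : A) = 0 := by
    refine hrad _ fun l => ?_
    rcases eq_or_ne l i with rfl | hl
    · simp only [map_sub, map_mul, map_smul, h.char_self, smul_eq_mul, one_mul, mul_one, sub_self]
    · simp only [map_sub, map_mul, map_smul, h.char_of_ne hl, zero_mul, smul_zero, sub_self]
  calc lam (b * s) = lam (e i * b * s) := by rw [mul_assoc, hij, mul_assoc, hse]
    _ = χ i b • lam (e i * s) := by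
      rw [sub_mul, sub_eq_zero, smul_mul_assoc] at hb
      rw [hb, map_smul]
    _ = χ i b • lam s := by rw [hij, hse]
    _ = lam (b * lam s • w) := by
      rw [mul_smul_comm, map_smul, hw, smul_eq_mul, smul_eq_mul, mul_comm]

theorem IsSplitBasicSystem.nonempty_socle_leftProj_equiv [FiniteDimensional k A]
    (h : IsSplitBasicSystem e χ) (hlam : IsFrobeniusForm lam)
    (hij : ∀ a, lam (e i * a) = lam (a * e j)) :
    Nonempty (socle A (leftProj (e j)) ≃ₗ[A] A ⧸ RingHom.ker (χ i)) := by
  obtain ⟨w, hw⟩ := hlam.exists_forall_apply_mul_eq (χ i).toLinearMap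
  have hwe : w * e j = w := hlam.eq_of_forall_apply_mul_eq fun b => by
    rw [← mul_assoc, ← hij, ← mul_assoc, hw, hw, AlgHom.toLinearMap_apply, map_mul, h.char_self,
      one_mul, AlgHom.toLinearMap_apply]
  let w' : leftProj (e j) := ⟨w, (mem_leftProj_iff (h.complete.idem j)).2 hwe⟩
  let f : A →ₗ[A] leftProj (e j) := LinearMap.toSpanSingleton A _ w'
  have hker : LinearMap.ker f = RingHom.ker (χ i) := by
    ext a
    rw [LinearMap.mem_ker, RingHom.mem_ker]
    refine ⟨fun ha => ?_, fun ha => Subtype.ext (hlam _ fun b => ?_)⟩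
    · have haw : a * w = 0 := congrArg Subtype.val ha
      rw [← AlgHom.toLinearMap_apply, ← hw, haw, map_zero]
    · rw [LinearMap.toSpanSingleton_apply, Submodule.coe_smul, smul_eq_mul, ← mul_assoc, hw,
        AlgHom.toLinearMap_apply, map_mul, ha, mul_zero]
  let φ : LinearMap.range f ≃ₗ[A] A ⧸ RingHom.ker (χ i) :=
    f.quotKerEquivRange.symm.trans (Submodule.quotEquivOfEq _ _ hker)
  have hsimple := isSimpleModule_quotient_ker (χ i)
  have hsocle : socle A (leftProj (e j)) = LinearMap.range f := by
    refine le_antisymm (fun s hs => ?_) (le_sSup (IsSimpleModule.congr φ))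
    refine ⟨algebraMap k A (lam s), Subtype.ext ?_⟩
    exact (Algebra.smul_def _ _).symm.trans (h.eq_smul_of_mem_socle hlam hij hw hs).symm
  exact ⟨(LinearEquiv.ofEq _ _ hsocle).trans φ⟩

variable [FiniteDimensional k A] {π : Equiv.Perm ι}

theorem IsSplitBasicSystem.isLeftNakayamaPermutation (h : IsSplitBasicSystem e χ)
    (hlam : IsFrobeniusForm lam) (hπ : ∀ i a, lam (e (π i) * a) = lam (a * e i)) :
    IsLeftNakayamaPermutation e π := fun i => by
  obtain ⟨φs⟩ := h.nonempty_socle_leftProj_equiv hlam (hπ i)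
  obtain ⟨φt⟩ := h.nonempty_top_leftProj_equiv (π i)
  exact ⟨φs.trans φt.symm⟩

theorem IsSplitBasicSystem.isNakayamaPermutation (h : IsSplitBasicSystem e χ)
    (hlam : IsFrobeniusForm lam) (hπ : ∀ i a, lam (e i * a) = lam (a * e (π i))) :
    IsNakayamaPermutation e π := fun i => by
  obtain ⟨φ⟩ := h.op.isLeftNakayamaPermutation hlam.op (fun i a => (hπ i a.unop).symm) i
  obtain ⟨φs⟩ := nonempty_socle_equiv (rightProjEquiv (e i))
  obtain ⟨φt⟩ := nonempty_top_equiv (rightProjEquiv (e (π i)))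
  exact ⟨(φs.trans φ).trans φt.symm⟩

end NakayamaPermutation

/-! ### Orbit algebras -/

theorem apply_zpow_of_semiconj {α β : Type*} {g : Equiv.Perm α} {h : Equiv.Perm β} {f : α → β}
    (hf : Function.Semiconj f g h) (i : ℤ) (a : α) : f ((g ^ i) a) = (h ^ i) (f a) := by
  induction i with
  | zero => rfl
  | succ i ih =>
    rw [add_comm, zpow_add, zpow_add, zpow_one, zpow_one, Equiv.Perm.mul_apply, hf, ih,
      Equiv.Perm.mul_apply]
  | pred i ih =>
    rw [sub_eq_neg_add, zpow_add, zpow_add, zpow_neg_one, zpow_neg_one, Equiv.Perm.mul_apply,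
      Equiv.Perm.mul_apply, ← ih, Equiv.Perm.eq_inv_iff_eq, ← hf]
    exact congrArg f (g.apply_symm_apply _)

section LinearAut

variable {k : Type u} [Field k] {C : Type w} [Category.{v} C] [Preadditive C] [Linear k C]

namespace LinearAut

variable (F : LinearAut k C)

/-- The permutation of the objects induced by an automorphism of a linear category. -/
noncomputable def objPerm : Equiv.Perm C := Equiv.ofBijective F.functor.obj F.obj_bijective

/-- The permutation of the morphisms induced by an automorphism of a linear category. -/
noncomputable def homPerm : Equiv.Perm (Σ P : C × C, P.1 ⟶ P.2) :=
  Equiv.sigmaCongr (Equiv.prodCongr F.objPerm F.objPerm) fun P => (F.homEquiv P.1 P.2).toEquiv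

theorem fst_homPerm_zpow (i : ℤ) (a : Σ P : C × C, P.1 ⟶ P.2) :
    ((F.homPerm ^ i) a).1 = ((F.objPerm ^ i) a.1.1, (F.objPerm ^ i) a.1.2) :=
  Prod.ext (apply_zpow_of_semiconj (f := fun a : Σ P : C × C, P.1 ⟶ P.2 => a.1.1)
      (fun _ => rfl) i a)
    (apply_zpow_of_semiconj (f := fun a : Σ P : C × C, P.1 ⟶ P.2 => a.1.2) (fun _ => rfl) i a)

/-- The group generated by the automorphism acts freely on the objects and the automorphism has
infinite order. -/
def IsFree : Prop := ∀ (X : C) (i : ℤ), (F.objPerm ^ i) X = X → i = 0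

variable {F}

theorem IsFree.eq_of_zpow_eq (hF : F.IsFree) {X : C} {i j : ℤ}
    (h : (F.objPerm ^ i) X = (F.objPerm ^ j) X) : i = j := by
  refine sub_eq_zero.1 (hF X _ ?_)
  rw [sub_eq_neg_add, zpow_add, Equiv.Perm.mul_apply, h, ← Equiv.Perm.mul_apply, ← zpow_add,
    neg_add_cancel, zpow_zero, Equiv.Perm.one_apply]

theorem IsFree.eq_of_sameCycle (hF : F.IsFree) {X Y : C} {q q' : X ⟶ Y}
    (h : F.homPerm.SameCycle ⟨(X, Y), q⟩ ⟨(X, Y), q'⟩) : q = q' := by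
  obtain ⟨i, hi⟩ := h
  have hX : (F.objPerm ^ i) X = X := by
    have := congrArg Sigma.fst hi
    rw [fst_homPerm_zpow] at this
    exact congrArg Prod.fst this
  rw [hF X i hX, zpow_zero, Equiv.Perm.one_apply] at hi
  exact eq_of_heq (Sigma.mk.inj hi).2

end LinearAut

namespace OrbitAlgebra

variable {F : LinearAut k C}

theorem iff_of_mem_orbit {P : C → Prop} (hP : ∀ X, P (F.functor.obj X) ↔ P X) {X Y : C}
    (h : Y ∈ orbit F X) : P Y ↔ P X := by
  induction (h : Relation.EqvGen _ X Y) with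
  | rel X Y h => exact h ▸ hP X
  | refl X => rfl
  | symm X Y _ ih => exact ih.symm
  | trans X Y Z _ _ ih₁ ih₂ => exact ih₂.trans ih₁

theorem mem_orbit_self (X : C) : X ∈ orbit F X := .refl X

theorem obj_mem_orbit_iff {X Y : C} : F.functor.obj Y ∈ orbit F X ↔ Y ∈ orbit F X :=
  ⟨fun h => h.trans _ _ _ (.symm _ _ (.rel Y _ rfl)), fun h => h.trans _ _ _ (.rel Y _ rfl)⟩

theorem mem_orbit_iff {X Y : C} : Y ∈ orbit F X ↔ F.objPerm.SameCycle X Y := by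
  refine ⟨fun h => (iff_of_mem_orbit (fun Z => ?_) h).2 (Equiv.Perm.SameCycle.refl _ X), ?_⟩
  · exact Equiv.Perm.sameCycle_apply_right
  · rintro ⟨i, rfl⟩
    have hbij : Set.BijOn F.objPerm (orbit F X) (orbit F X) :=
      F.objPerm.bijOn fun Y => obj_mem_orbit_iff
    exact (hbij.perm_zpow i).mapsTo (mem_orbit_self X)

open Classical in
/-- The entry at `(X', Y')` of the matrix whose entries are the translates of `p` under the group
generated by `F`, and zero elsewhere. If `F` acts freely, each entry has at most one candidate. -/
noncomputable def translateEntry (F : LinearAut k C) {X Y : C} (p : X ⟶ Y) (X' Y' : C) : X' ⟶ Y' :=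
  if h : ∃ q, F.homPerm.SameCycle ⟨(X, Y), p⟩ ⟨(X', Y'), q⟩ then h.choose else 0

theorem translateEntry_eq (hF : F.IsFree) {X Y X' Y' : C} {p : X ⟶ Y} {q : X' ⟶ Y'}
    (hq : F.homPerm.SameCycle ⟨(X, Y), p⟩ ⟨(X', Y'), q⟩) : translateEntry F p X' Y' = q := by
  have h : ∃ q, F.homPerm.SameCycle ⟨(X, Y), p⟩ ⟨(X', Y'), q⟩ := ⟨q, hq⟩
  exact (dif_pos h).trans (hF.eq_of_sameCycle (h.choose_spec.symm.trans hq))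

theorem exists_zpow_eq_of_translateEntry_ne_zero {X Y X' Y' : C} {p : X ⟶ Y}
    (h : translateEntry F p X' Y' ≠ 0) :
    ∃ i : ℤ, (F.objPerm ^ i) X = X' ∧ (F.objPerm ^ i) Y = Y' := by
  obtain ⟨q, i, hi⟩ : ∃ q, F.homPerm.SameCycle ⟨(X, Y), p⟩ ⟨(X', Y'), q⟩ := by
    by_contra hq
    exact h (dif_neg hq)
  have hfst := congrArg Sigma.fst hi
  rw [LinearAut.fst_homPerm_zpow] at hfst
  exact ⟨i, congrArg Prod.fst hfst, congrArg Prod.snd hfst⟩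

theorem translateEntry_map (hF : F.IsFree) {X Y : C} (p : X ⟶ Y) (X' Y' : C) :
    translateEntry F p (F.functor.obj X') (F.functor.obj Y') =
      F.functor.map (translateEntry F p X' Y') := by
  by_cases h : ∃ q, F.homPerm.SameCycle ⟨(X, Y), p⟩ ⟨(X', Y'), q⟩
  · obtain ⟨q, hq⟩ := h
    rw [translateEntry_eq hF hq]
    exact translateEntry_eq hF (Equiv.Perm.sameCycle_apply_right.2 hq)
  · rw [show translateEntry F p X' Y' = 0 from dif_neg h, F.map_zero]
    refine dif_neg ?_
    rintro ⟨q, hq⟩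
    obtain ⟨q, rfl⟩ := (F.map_bijective X' Y').2 q
    exact h ⟨q, Equiv.Perm.sameCycle_apply_right.1 hq⟩

theorem exists_entry_eq (hF : F.IsFree) {X Y : C} (p : X ⟶ Y) :
    ∃ f : OrbitAlgebra F, f.entry X Y = p ∧ ∀ X' Y', f.entry X' Y' ≠ 0 →
      ∃ i : ℤ, (F.objPerm ^ i) X = X' ∧ (F.objPerm ^ i) Y = Y' := by
  refine ⟨⟨translateEntry F p, fun X' => Set.Subsingleton.finite ?_,
    fun Y' => Set.Subsingleton.finite ?_, translateEntry_map hF p⟩,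
    translateEntry_eq hF (Equiv.Perm.SameCycle.refl _ _),
    fun X' Y' => exists_zpow_eq_of_translateEntry_ne_zero⟩
  · intro Y₁ h₁ Y₂ h₂
    obtain ⟨i, hiX, rfl⟩ := exists_zpow_eq_of_translateEntry_ne_zero h₁
    obtain ⟨j, hjX, rfl⟩ := exists_zpow_eq_of_translateEntry_ne_zero h₂
    rw [hF.eq_of_zpow_eq (hiX.trans hjX.symm)]
  · intro X₁ h₁ X₂ h₂
    obtain ⟨i, rfl, hiY⟩ := exists_zpow_eq_of_translateEntry_ne_zero h₁
    obtain ⟨j, rfl, hjY⟩ := exists_zpow_eq_of_translateEntry_ne_zero h₂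
    rw [hF.eq_of_zpow_eq (hiY.trans hjY.symm)]

theorem entry_eq_zero_of_mem_orbit {f : OrbitAlgebra F} {X : C} (hf : ∀ Y, f.entry X Y = 0)
    {X' : C} (hX' : X' ∈ orbit F X) (Y : C) : f.entry X' Y = 0 := by
  refine (iff_of_mem_orbit (P := fun Z => ∀ Y, f.entry Z Y = 0) (fun Z => ?_) hX').2 hf Y
  rw [F.obj_bijective.2.forall]
  refine forall_congr' fun Y => ?_
  rw [entry_map, ← F.homEquiv_apply, LinearEquiv.map_eq_zero_iff]

open Classical in
theorem entry_idempotent_self (X Y : C) :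
    (idempotent F X).entry Y Y = if Y ∈ orbit F X then 𝟙 Y else 0 := dif_pos rfl

theorem entry_idempotent_of_ne (X : C) {Y Z : C} (h : Y ≠ Z) : (idempotent F X).entry Y Z = 0 :=
  dif_neg h

open Classical in
theorem entry_idempotent_mul (X : C) (f : OrbitAlgebra F) (Y Z : C) :
    (idempotent F X * f).entry Y Z = if Z ∈ orbit F X then f.entry Y Z else 0 := by
  rw [entry_mul, finsum_eq_single _ Z fun q hq => by
    rw [entry_idempotent_of_ne X hq, Limits.comp_zero], entry_idempotent_self]
  split_ifs
  · exact Category.comp_id _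
  · exact Limits.comp_zero

open Classical in
theorem entry_mul_idempotent (X : C) (f : OrbitAlgebra F) (Y Z : C) :
    (f * idempotent F X).entry Y Z = if Y ∈ orbit F X then f.entry Y Z else 0 := by
  rw [entry_mul, finsum_eq_single _ Y fun q hq => by
    rw [entry_idempotent_of_ne X hq.symm, Limits.zero_comp], entry_idempotent_self]
  split_ifs
  · exact Category.id_comp _
  · exact Limits.zero_comp

/-- The map taking a matrix to its entry at `(X, Y)`. -/
def entryLinear (F : LinearAut k C) (X Y : C) : OrbitAlgebra F →ₗ[k] X ⟶ Y where
  toFun f := f.entry X Y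
  map_add' f g := entry_add f g X Y
  map_smul' c f := entry_smul c f X Y

theorem entry_sum {ι : Type*} (s : Finset ι) (f : ι → OrbitAlgebra F) (X Y : C) :
    (∑ i ∈ s, f i).entry X Y = ∑ i ∈ s, (f i).entry X Y :=
  map_sum (entryLinear F X Y) f s

theorem mul_mul_eq_zero {a b c : OrbitAlgebra F}
    (h : ∀ W X Y Z, c.entry W X ≫ b.entry X Y ≫ a.entry Y Z = 0) : a * b * c = 0 := by
  ext W Z
  rw [mul_assoc, entry_mul, entry_zero]
  refine finsum_eq_zero_of_forall_eq_zero fun Y => ?_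
  rw [entry_mul_eq_sum b c W Y (c.finite_left W).toFinset fun X hX =>
    (Set.Finite.mem_toFinset _).2 hX, Preadditive.sum_comp]
  exact Finset.sum_eq_zero fun X _ => (Category.assoc _ _ _).trans (h W X Y Z)

/-- A family of objects which meets every orbit of objects exactly once. -/
def IsTransversal {ι : Type*} (F : LinearAut k C) (X : ι → C) : Prop :=
  ∀ Y, ∃! i, Y ∈ orbit F (X i)

namespace IsTransversal

variable {ι : Type*} {X : ι → C}

theorem eq_zero (hX : IsTransversal F X) {f : OrbitAlgebra F}
    (h : ∀ i Y, f.entry (X i) Y = 0) : f = 0 := by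
  ext Y Z
  obtain ⟨i, hi, -⟩ := hX Y
  exact entry_eq_zero_of_mem_orbit (h i) hi Z

theorem completeOrthogonalIdempotents [Fintype ι] (hX : IsTransversal F X) :
    CompleteOrthogonalIdempotents fun i => idempotent F (X i) where
  idem i := by
    ext Y Z
    classical
    rw [entry_idempotent_mul]
    rcases eq_or_ne Y Z with rfl | hYZ
    · rw [entry_idempotent_self]
      split_ifs <;> rfl
    · rw [entry_idempotent_of_ne _ hYZ, ite_self]
  ortho i j hij := by
    ext Y Z
    classical
    rw [entry_idempotent_mul, entry_zero]
    refine ite_eq_right_iff.2 fun hi => ?_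
    rcases eq_or_ne Y Z with rfl | hYZ
    · rw [entry_idempotent_self, if_neg fun hj => hij ((hX Y).unique hi hj)]
    · exact entry_idempotent_of_ne _ hYZ
  complete := by
    ext Y Z
    classical
    rw [entry_sum]
    rcases eq_or_ne Y Z with rfl | hYZ
    · obtain ⟨i, hi, huniq⟩ := hX Y
      rw [entry_one_self, Finset.sum_eq_single i, entry_idempotent_self, if_pos hi]
      · exact fun j _ hji => by rw [entry_idempotent_self, if_neg (mt (huniq j) hji)]
      · exact fun h => absurd (Finset.mem_univ i) h
    · rw [entry_one_ne hYZ]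
      exact Finset.sum_eq_zero fun i _ => entry_idempotent_of_ne _ hYZ

end IsTransversal

end OrbitAlgebra

end LinearAut

/-! ### Twisted extensions -/

section TwistedExtension

variable {k : Type u} [Field k] {C : Type w} [Category.{v} C] [Preadditive C] [Linear k C]

namespace Repetition

/-- The map taking a morphism of the repetition to its component in `C`. -/
def homFstLinear (X Y : Repetition k C) : (X ⟶ Y) →ₗ[k] X.base ⟶ Y.base where
  toFun := homFst
  map_add' := homFst_add
  map_smul' := homFst_smul

/-- The map taking a morphism of the repetition to its component in `D C`. -/
def homSndLinear (X Y : Repetition k C) : (X ⟶ Y) →ₗ[k] Module.Dual k (Y.base ⟶ X.base) where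
  toFun := homSnd
  map_add' := homSnd_add
  map_smul' := homSnd_smul

instance finite_hom [∀ X Y : C, Module.Finite k (X ⟶ Y)] (X Y : Repetition k C) :
    Module.Finite k (X ⟶ Y) :=
  Module.Finite.of_injective ((homFstLinear X Y).prod (homSndLinear X Y)) fun _ _ h =>
    hom_ext (congrArg Prod.fst h) (congrArg Prod.snd h)

theorem hom_eq_zero_of_level {X Y : Repetition k C} (f : X ⟶ Y) (h₀ : Y.level ≠ X.level)
    (h₁ : Y.level ≠ X.level + 1) : f = 0 :=
  hom_ext (homFst_eq_zero f h₀) (homSnd_eq_zero f h₁)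

theorem eq_zero_of_forall_homSnd_comp {X Y : Repetition k C} {q : X ⟶ Y}
    (hq : ∀ p : Y ⟶ ⟨X.base, X.level + 1⟩, homSnd (q ≫ p) (𝟙 X.base) = 0) : q = 0 := by
  refine hom_ext ?_ ?_
  · by_cases hY : Y.level = X.level
    · refine (Module.forall_dual_apply_eq_zero_iff k _).1 fun ψ => ?_
      have h := hq (homMk 0 ψ (fun _ => rfl) fun h => absurd (congrArg (· + 1) hY.symm) h)
      rw [homSnd_comp, LinearMap.add_apply, dualComp_apply, compDual_apply, homFst_homMk,
        homSnd_homMk, Limits.zero_comp, _root_.map_zero, zero_add] at h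
      rwa [← Category.id_comp (homFst q)]
    · exact homFst_eq_zero q hY
  · by_cases hY : Y.level = X.level + 1
    · ext g
      have h := hq (homMk g 0 (fun h => absurd hY.symm h) fun _ => rfl)
      rw [homSnd_comp, LinearMap.add_apply, dualComp_apply, compDual_apply, homFst_homMk,
        homSnd_homMk, LinearMap.zero_apply, add_zero] at h
      rwa [← Category.comp_id g]
    · exact homSnd_eq_zero q hY

end Repetition

section Orbits

variable {φ : LinearAut k C} {d : ℤ}

theorem objPerm_twist_zpow (i : ℤ) (X : Repetition k C) :
    ((twist φ d).objPerm ^ i) X = ⟨(φ.objPerm ^ i) X.base, X.level + i * d⟩ := by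
  refine Repetition.ext
    (apply_zpow_of_semiconj (f := Repetition.base) (h := φ.objPerm) (fun _ => rfl) i X)
    ((apply_zpow_of_semiconj (f := Repetition.level) (h := AddAction.toPerm d)
      (fun Y => add_comm Y.level d) i X).trans ?_)
  have hzsmul : AddAction.toPerm (i • d) = (AddAction.toPerm d : Equiv.Perm ℤ) ^ i :=
    congrArg Additive.toMul (map_zsmul (AddAction.toPermHom ℤ ℤ) i d)
  rw [← hzsmul]
  exact add_comm _ _

theorem isFree_twist (hd : d ≠ 0) : (twist φ d).IsFree := fun X i hi => by
  rw [objPerm_twist_zpow] at hi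
  exact (mul_eq_zero_iff_right hd).1 (left_eq_add.1 (congrArg Repetition.level hi).symm)

theorem eq_of_mem_orbit_of_level_eq (hd : d ≠ 0) {X Y Z : Repetition k C}
    (hY : Y ∈ OrbitAlgebra.orbit (twist φ d) X) (hZ : Z ∈ OrbitAlgebra.orbit (twist φ d) X)
    (h : Y.level = Z.level) : Y = Z := by
  obtain ⟨i, rfl⟩ := OrbitAlgebra.mem_orbit_iff.1 hY
  obtain ⟨j, rfl⟩ := OrbitAlgebra.mem_orbit_iff.1 hZ
  simp only [objPerm_twist_zpow, add_right_inj, mul_left_inj' hd] at h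
  rw [h]

variable {ι : Type*}

theorem isTransversal_twist (hd : IsUnit d) (X : ι ≃ C) :
    OrbitAlgebra.IsTransversal (twist φ d) fun i => ⟨X i, 0⟩ := by
  intro Y
  have hdd : d * d = 1 := Int.isUnit_mul_self hd
  have horbit (x : C) :
      Y ∈ OrbitAlgebra.orbit (twist φ d) ⟨x, 0⟩ ↔ (φ.objPerm ^ (Y.level * d)) x = Y.base := by
    rw [OrbitAlgebra.mem_orbit_iff]
    refine ⟨?_, fun h => ⟨Y.level * d, ?_⟩⟩
    · rintro ⟨i, rfl⟩
      simp only [objPerm_twist_zpow, zero_add, mul_assoc, hdd, mul_one]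
    · rw [objPerm_twist_zpow]
      exact Repetition.ext h (by rw [zero_add, mul_assoc, hdd, mul_one])
  simp only [horbit]
  exact (X.trans (φ.objPerm ^ (Y.level * d))).bijective.existsUnique Y.base

end Orbits

/-- A linear category over `k` with radical square zero and with endomorphism algebras `k`, and
with finite-dimensional morphism spaces. For distinct objects all morphisms are radical. -/
structure IsSplitRadicalSquareZero (k : Type u) [Field k] (C : Type w) [Category.{v} C]
    [Preadditive C] [Linear k C] : Prop where
  finite_hom (X Y : C) : Module.Finite k (X ⟶ Y)
  bijective_algebraMap (X : C) : Function.Bijective (algebraMap k (End X))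
  comp_eq_zero {X Y Z : C} (f : X ⟶ Y) (g : Y ⟶ Z) (hXY : X ≠ Y) (hYZ : Y ≠ Z) : f ≫ g = 0

namespace IsSplitRadicalSquareZero

variable (hC : IsSplitRadicalSquareZero k C) {W X Y Z : C}
include hC

/-- The endomorphism algebras are identified with the ground field by the structure map. -/
noncomputable def endEquiv (X : C) : End X ≃ₐ[k] k :=
  (AlgEquiv.ofBijective (Algebra.ofId k (End X)) (hC.bijective_algebraMap X)).symm

theorem comp_eq_zero_of_radical {f : X ⟶ Y} {g : Y ⟶ Z} (hf : X = Y → f = 0)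
    (hg : Y = Z → g = 0) : f ≫ g = 0 := by
  by_cases hXY : X = Y
  · rw [hf hXY, Limits.zero_comp]
  by_cases hYZ : Y = Z
  · rw [hg hYZ, Limits.comp_zero]
  exact hC.comp_eq_zero f g hXY hYZ

theorem comp_comp_eq_zero_of_radical {f : W ⟶ X} {h : X ⟶ Y} {g : Y ⟶ Z} (hf : W = X → f = 0)
    (hg : Y = Z → g = 0) : f ≫ h ≫ g = 0 := by
  by_cases hXY : X = Y
  · subst hXY
    obtain ⟨c, rfl⟩ := (hC.bijective_algebraMap X).2 h
    rw [show algebraMap k (End X) c = c • 𝟙 X from Algebra.algebraMap_eq_smul_one c,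
      Linear.smul_comp, Category.id_comp, Linear.comp_smul, hC.comp_eq_zero_of_radical hf hg,
      smul_zero]
  · rw [← Category.assoc, hC.comp_eq_zero_of_radical hf fun h => absurd h hXY, Limits.zero_comp]

theorem repetition_comp_comp_eq_zero {W X Y Z : Repetition k C} {p : W ⟶ X} {q : X ⟶ Y}
    {r : Y ⟶ Z} (hp : W.base = X.base → Repetition.homFst p = 0)
    (hq : X.base = Y.base → Repetition.homFst q = 0)
    (hr : Y.base = Z.base → Repetition.homFst r = 0) : p ≫ q ≫ r = 0 := by
  refine Repetition.hom_ext ?_ (LinearMap.ext fun h => ?_)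
  · rw [Repetition.homFst_comp, Repetition.homFst_comp, ← Category.assoc,
      hC.comp_eq_zero_of_radical hp hq, Limits.zero_comp]
    rfl
  · rw [Repetition.homSnd_comp, Repetition.homSnd_comp, Repetition.homFst_comp,
      LinearMap.add_apply, Repetition.dualComp_apply, Repetition.compDual_apply,
      LinearMap.add_apply, Repetition.dualComp_apply, Repetition.compDual_apply,
      hC.comp_eq_zero_of_radical hq hr, hC.comp_comp_eq_zero_of_radical hr hp, Category.assoc,
      hC.comp_eq_zero_of_radical hp hq]
    simp only [Limits.zero_comp, Limits.comp_zero, map_zero, add_zero]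
    rfl

end IsSplitRadicalSquareZero

namespace TwistedExtension

open Repetition OrbitAlgebra

variable {φ : LinearAut k C} {d : ℤ}

theorem finite [Finite C] [∀ X Y : C, Module.Finite k (X ⟶ Y)] (hd : IsUnit d) :
    Module.Finite k (TwistedExtension φ d) := by
  have := Fintype.ofFinite C
  let T : TwistedExtension φ d →ₗ[k]
      ∀ x y : C, ((⟨x, 0⟩ : Repetition k C) ⟶ ⟨y, 0⟩) × ((⟨x, 0⟩ : Repetition k C) ⟶ ⟨y, 1⟩) :=
    LinearMap.pi fun x => LinearMap.pi fun y =>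
      (entryLinear (twist φ d) ⟨x, 0⟩ ⟨y, 0⟩).prod (entryLinear (twist φ d) ⟨x, 0⟩ ⟨y, 1⟩)
  refine Module.Finite.of_injective T (LinearMap.ker_eq_bot.1 (LinearMap.ker_eq_bot'.2 fun f hf =>
    (isTransversal_twist hd (Equiv.refl C)).eq_zero fun x ⟨y, l⟩ => ?_))
  have hf' := congrFun (congrFun hf x) y
  by_cases h₀ : l = 0
  · subst h₀
    exact congrArg Prod.fst hf'
  by_cases h₁ : l = 1
  · subst h₁
    exact congrArg Prod.snd hf'
  exact hom_eq_zero_of_level _ h₀ h₁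

section TraceForm

variable {ι : Type*} [Fintype ι] (X : ι ≃ C)

/-- The trace form on the twisted extension: the sum of the values of the components in
`D C(x, x)` at `𝟙 x`. -/
noncomputable def traceForm (φ : LinearAut k C) (d : ℤ) : Module.Dual k (TwistedExtension φ d) :=
  ∑ i, LinearMap.applyₗ (𝟙 (X i)) ∘ₗ homSndLinear ⟨X i, 0⟩ ⟨X i, 1⟩ ∘ₗ
    entryLinear (twist φ d) ⟨X i, 0⟩ ⟨X i, 1⟩

theorem traceForm_apply (f : TwistedExtension φ d) :
    traceForm X φ d f = ∑ i, homSnd (f.entry ⟨X i, 0⟩ ⟨X i, 1⟩) (𝟙 (X i)) :=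
  LinearMap.sum_apply _ _ _

theorem traceForm_vertexIdempotent_mul (hd : d ≠ 0) {i j : ι}
    (hij : (⟨X j, 1⟩ : Repetition k C) ∈ orbit (twist φ d) ⟨X i, 0⟩) (f : TwistedExtension φ d) :
    traceForm X φ d (vertexIdempotent φ d (X i) * f) =
      traceForm X φ d (f * vertexIdempotent φ d (X j)) := by
  classical
  rw [traceForm_apply, traceForm_apply]
  refine Finset.sum_congr rfl fun l _ => ?_
  have hl : (⟨X l, 1⟩ : Repetition k C) ∈ orbit (twist φ d) ⟨X i, 0⟩ ↔
      (⟨X l, 0⟩ : Repetition k C) ∈ orbit (twist φ d) ⟨X j, 0⟩ := by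
    constructor <;> intro h
    · rw [X.injective (congrArg base (eq_of_mem_orbit_of_level_eq hd h hij rfl))]
      exact mem_orbit_self _
    · rwa [X.injective (congrArg base (eq_of_mem_orbit_of_level_eq hd h (mem_orbit_self _) rfl))]
  rw [vertexIdempotent, vertexIdempotent, entry_idempotent_mul, entry_mul_idempotent]
  simp only [hl]

theorem traceForm_mul_eq (hd : d ≠ 0) {i : ι} {Y : Repetition k C} {f g : TwistedExtension φ d}
    (hg : ∀ Y' Z', g.entry Y' Z' ≠ 0 →
      ∃ m : ℤ, ((twist φ d).objPerm ^ m) Y = Y' ∧ ((twist φ d).objPerm ^ m) ⟨X i, 1⟩ = Z') :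
    traceForm X φ d (g * f) =
      homSnd (f.entry ⟨X i, 0⟩ Y ≫ g.entry Y ⟨X i, 1⟩) (𝟙 (X i)) := by
  have hsupport {Y' : Repetition k C} {j : ι} (h : g.entry Y' ⟨X j, 1⟩ ≠ 0) : Y' = Y ∧ j = i := by
    obtain ⟨m, rfl, hm⟩ := hg _ _ h
    rw [objPerm_twist_zpow] at hm
    obtain rfl : m = 0 := (mul_eq_zero_iff_right hd).1 (left_eq_add.1 (congrArg level hm).symm)
    exact ⟨rfl, (X.injective (congrArg base hm)).symm⟩
  rw [traceForm_apply, Finset.sum_eq_single i]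
  · rw [entry_mul, finsum_eq_single _ Y fun Y' hY' => ?_]
    rw [not_imp_comm.1 (fun h => (hsupport h).1) hY', Limits.comp_zero]
  · intro j _ hj
    rw [entry_mul, finsum_eq_zero_of_forall_eq_zero fun Y' => ?_]
    · rfl
    · rw [not_imp_comm.1 (fun h => (hsupport h).2) hj, Limits.comp_zero]
  · exact fun h => absurd (Finset.mem_univ i) h

theorem isFrobeniusForm_traceForm (hd : IsUnit d) : IsFrobeniusForm (traceForm X φ d) := by
  intro f hf
  refine (isTransversal_twist hd X).eq_zero fun i Y =>
    eq_zero_of_forall_homSnd_comp fun (p : Y ⟶ ⟨X i, 1⟩) => ?_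
  obtain ⟨g, rfl, hg⟩ := exists_entry_eq (isFree_twist (φ := φ) hd.ne_zero) p
  rw [← hf g]
  exact (traceForm_mul_eq X hd.ne_zero hg).symm

end TraceForm

theorem isSelfInjectiveAlgebra [Finite C] [∀ X Y : C, Module.Finite k (X ⟶ Y)] (hd : IsUnit d) :
    IsSelfInjectiveAlgebra k (TwistedExtension φ d) :=
  have := Fintype.ofFinite C
  have := finite (φ := φ) hd
  (isFrobeniusForm_traceForm (Equiv.refl C) hd).isSelfInjectiveAlgebra

section Characters

variable (hC : IsSplitRadicalSquareZero k C)
include hC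

theorem homFst_entry_mul_self (f g : TwistedExtension φ d) (P : Repetition k C) :
    homFst ((f * g).entry P P) = homFst (g.entry P P) ≫ homFst (f.entry P P) := by
  have hfinite := (g.finite_left P).subset (OrbitAlgebra.support_comp_left f g P P)
  rw [entry_mul]
  refine ((homFstLinear P P).toAddMonoidHom.map_finsum hfinite).trans ?_
  refine finsum_eq_single _ P fun Q hQ => ?_
  -- A closed walk through another object of the same level is a product of two radical morphisms.
  change homFst (g.entry P Q) ≫ homFst (f.entry Q P) = 0
  by_cases hlevel : Q.level = P.level
  · have hbase : Q.base ≠ P.base := fun h => hQ (Repetition.ext h hlevel)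
    exact hC.comp_eq_zero _ _ hbase.symm hbase
  · rw [homFst_eq_zero _ hlevel, Limits.zero_comp]

/-- The action of the twisted extension on the top of the projective module at the object `x`,
as a map to the endomorphism ring of `x`. -/
noncomputable def endChar (φ : LinearAut k C) (d : ℤ) (x : C) : TwistedExtension φ d →ₐ[k] End x :=
  AlgHom.ofLinearMap
    (homFstLinear (⟨x, 0⟩ : Repetition k C) ⟨x, 0⟩ ∘ₗ entryLinear (twist φ d) ⟨x, 0⟩ ⟨x, 0⟩)
    (congrArg homFst (entry_one_self (F := twist φ d) ⟨x, 0⟩))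
    fun f g => homFst_entry_mul_self hC f g ⟨x, 0⟩

/-- The character of the twisted extension at the object `x`: the component in `End x = k` of the
entry at `x^[0]`. -/
noncomputable def vertexChar (φ : LinearAut k C) (d : ℤ) (x : C) : TwistedExtension φ d →ₐ[k] k :=
  (hC.endEquiv x).toAlgHom.comp (endChar hC φ d x)

theorem vertexChar_eq_zero_iff {f : TwistedExtension φ d} {x : C} :
    vertexChar hC φ d x f = 0 ↔ homFst (f.entry ⟨x, 0⟩ ⟨x, 0⟩) = 0 :=
  map_eq_zero_iff (hC.endEquiv x) (hC.endEquiv x).injective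

theorem vertexChar_vertexIdempotent (x : C) :
    vertexChar hC φ d x (vertexIdempotent φ d x) = 1 := by
  refine (congrArg (hC.endEquiv x) ?_).trans (map_one (hC.endEquiv x))
  exact congrArg homFst
    ((entry_idempotent_self (F := twist φ d) _ _).trans (if_pos (mem_orbit_self _)))

theorem homFst_entry_eq_zero {ι : Type*} {X : ι ≃ C} (hd : IsUnit d) {f : TwistedExtension φ d}
    (hf : ∀ i, vertexChar hC φ d (X i) f = 0) {P Q : Repetition k C} (hPQ : P.base = Q.base) :
    homFst (f.entry P Q) = 0 := by
  by_cases hlevel : Q.level = P.level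
  · obtain rfl : P = Q := Repetition.ext hPQ hlevel.symm
    obtain ⟨i, hi, -⟩ := isTransversal_twist (φ := φ) hd X P
    refine (iff_of_mem_orbit (P := fun Z => homFst (f.entry Z Z) = 0) (fun Z => ?_) hi).2
      ((vertexChar_eq_zero_iff hC).1 (hf i))
    rw [entry_map]
    exact map_eq_zero_iff (φ.homEquiv Z.base Z.base) (φ.homEquiv _ _).injective
  · exact homFst_eq_zero _ hlevel

theorem mul_mul_eq_zero_of_vertexChar {ι : Type*} {X : ι ≃ C} (hd : IsUnit d)
    {a b c : TwistedExtension φ d} (ha : ∀ i, vertexChar hC φ d (X i) a = 0)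
    (hb : ∀ i, vertexChar hC φ d (X i) b = 0) (hc : ∀ i, vertexChar hC φ d (X i) c = 0) :
    a * b * c = 0 :=
  OrbitAlgebra.mul_mul_eq_zero fun _ _ _ _ => hC.repetition_comp_comp_eq_zero
    (homFst_entry_eq_zero hC hd hc) (homFst_entry_eq_zero hC hd hb)
    (homFst_entry_eq_zero hC hd ha)

theorem isSplitBasicSystem {ι : Type*} [Fintype ι] (X : ι ≃ C) (hd : IsUnit d) :
    IsSplitBasicSystem (fun i => vertexIdempotent φ d (X i)) fun i => vertexChar hC φ d (X i) where
  complete := (isTransversal_twist hd X).completeOrthogonalIdempotents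
  char_self i := vertexChar_vertexIdempotent hC (X i)
  isNilpotent a ha := ⟨3, by
    rw [pow_succ, pow_two, mul_mul_eq_zero_of_vertexChar hC hd ha ha ha]⟩

theorem jacobson_pow_three_eq_bot [Finite C] (hd : IsUnit d) :
    Ring.jacobson (TwistedExtension φ d) ^ 3 = ⊥ :=
  have := Fintype.ofFinite C
  (isSplitBasicSystem hC (Equiv.refl C) hd).jacobson_pow_three_eq_bot fun _ _ _ =>
    mul_mul_eq_zero_of_vertexChar hC hd

variable {ι : Type*} [Finite ι] (X : ι ≃ C) {π : Equiv.Perm ι}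

theorem isNakayamaPermutation (hd : IsUnit d)
    (hπ : ∀ i, (⟨X (π i), 1⟩ : Repetition k C) ∈ orbit (twist φ d) ⟨X i, 0⟩) :
    IsNakayamaPermutation (fun i => vertexIdempotent φ d (X i)) π :=
  have := Fintype.ofFinite ι
  have := Finite.of_equiv ι X
  have := hC.finite_hom
  have := finite (φ := φ) hd
  (isSplitBasicSystem hC X hd).isNakayamaPermutation (isFrobeniusForm_traceForm X hd)
    fun i => traceForm_vertexIdempotent_mul X hd.ne_zero (hπ i)

theorem isLeftNakayamaPermutation (hd : IsUnit d)
    (hπ : ∀ i, (⟨X i, 1⟩ : Repetition k C) ∈ orbit (twist φ d) ⟨X (π i), 0⟩) :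
    IsLeftNakayamaPermutation (fun i => vertexIdempotent φ d (X i)) π :=
  have := Fintype.ofFinite ι
  have := Finite.of_equiv ι X
  have := hC.finite_hom
  have := finite (φ := φ) hd
  (isSplitBasicSystem hC X hd).isLeftNakayamaPermutation (isFrobeniusForm_traceForm X hd)
    fun i => traceForm_vertexIdempotent_mul X hd.ne_zero (hπ i)

end Characters

end TwistedExtension

end TwistedExtension

/-! ### Quivers without composable arrows -/

section PathCategory

variable {k : Type u} [Field k] {V : Type w} [Quiver.{v} V]

/-- A quiver all of whose paths have length at most one: every vertex is a source or a sink. -/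
def HasNoComposableArrows (V : Type w) [Quiver.{v} V] : Prop :=
  ∀ ⦃a b c : V⦄, (a ⟶ b) → IsEmpty (b ⟶ c)

theorem pathCategory_hom_eq_zero {X Y : PathCategory k V} [IsEmpty (Quiver.Path (V := V) X Y)]
    (f : X ⟶ Y) : f = 0 :=
  Subsingleton.elim (α := Quiver.Path (V := V) X Y →₀ k) f 0

theorem pathCategory_algebraMap_apply (X : PathCategory k V) (c : k) :
    algebraMap k (End X) c =
      (Finsupp.single .nil c : Quiver.Path (V := V) X X →₀ k) :=
  (Algebra.algebraMap_eq_smul_one c).trans ((Finsupp.smul_single' c _ 1).trans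
    (congrArg (Finsupp.single _) (mul_one c)))

namespace HasNoComposableArrows

variable (hV : HasNoComposableArrows V)
include hV

theorem length_eq_zero_of_arrow {a b c : V} (p : Quiver.Path a b) (f : b ⟶ c) : p.length = 0 := by
  cases p with
  | nil => rfl
  | cons p g => exact ((hV g).false f).elim

theorem length_eq_zero_or_exists_eq_toPath {a b : V} (p : Quiver.Path a b) :
    p.length = 0 ∨ ∃ f : a ⟶ b, p = f.toPath := by
  cases p with
  | nil => exact .inl rfl
  | cons p f =>
    have hp := hV.length_eq_zero_of_arrow p f
    obtain rfl := Quiver.Path.eq_of_length_zero p hp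
    obtain rfl := Quiver.Path.eq_nil_of_length_zero p hp
    exact .inr ⟨f, rfl⟩

theorem eq_nil {a : V} (p : Quiver.Path a a) : p = .nil := by
  rcases hV.length_eq_zero_or_exists_eq_toPath p with hp | ⟨f, -⟩
  · exact Quiver.Path.eq_nil_of_length_zero p hp
  · exact ((hV f).false f).elim

theorem exists_eq_toPath {a b : V} (p : Quiver.Path a b) (hab : a ≠ b) :
    ∃ f : a ⟶ b, f.toPath = p := by
  rcases hV.length_eq_zero_or_exists_eq_toPath p with hp | ⟨f, hf⟩
  · exact absurd (Quiver.Path.eq_of_length_zero p hp) hab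
  · exact ⟨f, hf.symm⟩

theorem finite_path [∀ a b : V, Finite (a ⟶ b)] (a b : V) : Finite (Quiver.Path a b) := by
  rcases eq_or_ne a b with rfl | hab
  · have : Subsingleton (Quiver.Path a a) := ⟨fun p q => (hV.eq_nil p).trans (hV.eq_nil q).symm⟩
    infer_instance
  · exact Finite.of_surjective Quiver.Hom.toPath fun p => hV.exists_eq_toPath p hab

theorem isSplitRadicalSquareZero (k : Type u) [Field k] [∀ a b : V, Finite (a ⟶ b)] :
    IsSplitRadicalSquareZero k (PathCategory k V) where
  finite_hom X Y :=
    have := hV.finite_path (V := V) X Y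
    inferInstanceAs (Module.Finite k (Quiver.Path (V := V) X Y →₀ k))
  bijective_algebraMap X := by
    rw [show ⇑(algebraMap k (End X)) = _ from funext (pathCategory_algebraMap_apply X)]
    refine ⟨Finsupp.single_injective _, fun (f : Quiver.Path (V := V) X X →₀ k) =>
      ⟨f .nil, Finsupp.ext fun p => ?_⟩⟩
    rw [hV.eq_nil p, Finsupp.single_eq_same]
  comp_eq_zero {X Y Z} f g hXY hYZ := by
    by_cases hp : IsEmpty (Quiver.Path (V := V) X Y)
    · rw [pathCategory_hom_eq_zero f, Limits.zero_comp]
    obtain ⟨p⟩ := not_isEmpty_iff.1 hp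
    obtain ⟨a, -⟩ := hV.exists_eq_toPath p hXY
    have hq : IsEmpty (Quiver.Path (V := V) Y Z) :=
      ⟨fun q => (hV a).false (hV.exists_eq_toPath q hYZ).choose⟩
    rw [pathCategory_hom_eq_zero g, Limits.comp_zero]

end HasNoComposableArrows

end PathCategory

namespace CycleDecomposition

variable {n : ℕ} {σ : Equiv.Perm (Fin n)} (D : CycleDecomposition σ)

theorem even_and_odd_of_arrow {a b : D.Vertex} (f : a ⟶ b) : Even (a.1 : ℕ) ∧ Odd (b.1 : ℕ) := by
  rcases (D.arrow_iff a b).1 ⟨f⟩ with ⟨hab, ha⟩ | ⟨hab, hb⟩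
  · exact ⟨ha, hab ▸ ha.add_one⟩
  · exact ⟨hab ▸ hb.add_one, hb⟩

theorem hasNoComposableArrows : HasNoComposableArrows D.Vertex := fun _ _ _ f =>
  ⟨fun g => Nat.not_even_iff_odd.2 (D.even_and_odd_of_arrow f).2 (D.even_and_odd_of_arrow g).1⟩

theorem quiverAut_obj_vertex (i : Fin n) :
    D.quiverAut.toPrefunctor.obj (D.vertex i) = D.vertex (σ i) :=
  D.x.injective ((D.x_quiverAut _).trans ((congrArg σ (D.x.apply_symm_apply i)).trans
    (D.x.apply_symm_apply (σ i)).symm))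

end CycleDecomposition

end TwistedExt

open TwistedExt in
theorem mainTheorem12_general {k : Type u} [Field k] {C : Type w} [Category.{v} C] [Preadditive C]
    [Linear k C] (hC : IsSplitRadicalSquareZero k C) (φ : LinearAut k C) {ι : Type*} [Fintype ι]
    (X : ι ≃ C) (π : Equiv.Perm ι) (hπ : ∀ i, φ.functor.obj (X i) = X (π i)) :
    (IsSelfInjectiveAlgebra k (TwistedExtension φ 1) ∧
      Ring.jacobson (TwistedExtension φ 1) ^ 3 = ⊥ ∧
      IsBasicSystem (fun i => vertexIdempotent φ 1 (X i)) ∧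
      IsNakayamaPermutation (fun i => vertexIdempotent φ 1 (X i)) π) ∧
    (IsSelfInjectiveAlgebra k (TwistedExtension φ (-1)) ∧
      Ring.jacobson (TwistedExtension φ (-1)) ^ 3 = ⊥ ∧
      IsBasicSystem (fun i => vertexIdempotent φ (-1) (X i)) ∧
      IsLeftNakayamaPermutation (fun i => vertexIdempotent φ (-1) (X i)) π) := by
  have := Finite.of_equiv ι X
  have := hC.finite_hom
  have hpos : IsUnit (1 : ℤ) := isUnit_one
  have hneg : IsUnit (-1 : ℤ) := isUnit_one.neg
  refine ⟨⟨TwistedExtension.isSelfInjectiveAlgebra hpos,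
      TwistedExtension.jacobson_pow_three_eq_bot hC hpos,
      (TwistedExtension.isSplitBasicSystem hC X hpos).isBasicSystem,
      TwistedExtension.isNakayamaPermutation hC X hpos fun i => ?_⟩,
    TwistedExtension.isSelfInjectiveAlgebra hneg,
    TwistedExtension.jacobson_pow_three_eq_bot hC hneg,
    (TwistedExtension.isSplitBasicSystem hC X hneg).isBasicSystem,
    TwistedExtension.isLeftNakayamaPermutation hC X hneg fun i => ?_⟩
  · exact .rel _ _ (Repetition.ext (hπ i) rfl)
  · exact .symm _ _ (.rel _ _ (Repetition.ext (hπ i) rfl))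

theorem mainTheorem12 (k : Type u) [Field k] {n : ℕ} (σ : Equiv.Perm (Fin n))
    (D : TwistedExt.CycleDecomposition σ) :
    (TwistedExt.IsSelfInjectiveAlgebra k (D.Extension k 1) ∧
      Ring.jacobson (D.Extension k 1) ^ 3 = ⊥ ∧
      TwistedExt.IsBasicSystem (D.idempotent k 1) ∧
      TwistedExt.IsNakayamaPermutation (D.idempotent k 1) σ) ∧
    (TwistedExt.IsSelfInjectiveAlgebra k (D.Extension k (-1)) ∧
      Ring.jacobson (D.Extension k (-1)) ^ 3 = ⊥ ∧
      TwistedExt.IsBasicSystem (D.idempotent k (-1)) ∧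
      TwistedExt.IsLeftNakayamaPermutation (D.idempotent k (-1)) σ) :=
  mainTheorem12_general (D.hasNoComposableArrows.isSplitRadicalSquareZero k) (D.pathAut k)
    D.x.symm σ D.quiverAut_obj_vertex
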